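/- Conventions. $\mathscr D(\mathbb R)$ is the space of complex-valued compactly supported $C^\infty$ functions on $\mathbb R$ and $\mathscr D'(\mathbb R)$ its topological dual. $\hat f(\xi)=\int_{\mathbb R} f(x)e^{-ix\xi}\,dx$, extended to $L_2(\mathbb R)$. For $\lambda\ne0$ and $k,n\in\mathbb R$ put $f_{\lambda;k,n}(x)=|\lambda|^{1/2}e^{-in\lambda x}f(\lambda x-k)$ and $f_{\lambda;k}=f_{\lambda;k,0}$, extended to distributions by duality. For functions, $\langle f,g\rangle=\int f\,\overline g$; for $\mathbf f\in\mathscr D(\mathbb R)$ and $T\in\mathscr D'(\mathbb R)$, $\langle T,\mathbf f\rangle=T(\overline{\mathbf f})$ and $\langle \mathbf f,T\rangle=\overline{\langle T,\mathbf f\rangle}$. Locally integrable functions are identified with distributions, and $L_{2,loc}(\mathbb R)$ is the space of measurable functions that are square integrable on every compact set. Let $J\in\mathbb Z$ and let $\{\lambda_j\}_{j=J}^\infty$ be nonzero real numbers with $\lim_{j\to+\infty}\lambda_j=0$. Let $\Phi=\{\varphi^1,\dots,\varphi^r\}$ and $\Psi^j=\{\psi^{j,1},\dots,\psi^{j,s_j}\}$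 ($j\ge J$) be finite families of distributions in $\mathscr D'(\mathbb R)$ (repetitions allowed). For families of functions $u=\{u^1,\dots,u^m\}$ put $$I_u^\kappa(\xi)=\sum_{\ell=1}^m\overline{u^\ell(\xi)}\,u^\ell(\xi+2\pi \kappa)\ \ (\kappa\in\mathbb Z),\qquad I_u^\kappa\equiv0\ \ (\kappa\in\mathbb R\setminus\mathbb Z),$$ and let $\Lambda=\bigcup_{j\ge J}\lambda_j^{-1}\mathbb Z$. Then the following four statements are equivalent. 1. (Frequency-based nonstationary tight wavelet frame in $L_2(\mathbb R)$.) $\Phi,\Psi^j\subseteq L_2(\mathbb R)$ for all $j\ge J$ and $$\sum_{\ell=1}^r\sum_{k\in\mathbb Z}|\langle \mathbf f,\varphi^\ell_{\lambda_J;0,k}\rangle|^2+\sum_{j=J}^\infty\sum_{\ell=1}^{s_j}\sum_{k\in\mathbb Z}|\langle \mathbf f,\psi^{j,\ell}_{\lambda_j;0,k}\rangle|^2=2\pi\|\mathbf f\|_{L_2(\mathbb R)}^2\qquad\forall\,\mathbf f\in L_2(\mathbb R).$$ 2. (The system is a pair of frequency-based nonstationary dual wavelet frames in $\mathscr D'(\mathbb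 R)$ with itself.) For all $\mathbf f,\mathbf g\in\mathscr D(\mathbb R)$, the series $\sum_{k\in\mathbb Z}\langle \mathbf f,\varphi^\ell_{\lambda_J;0,k}\rangle\langle\varphi^\ell_{\lambda_J;0,k},\mathbf g\rangle$ ($1\le\ell\le r$) and $\sum_{k\in\mathbb Z}\langle \mathbf f,\psi^{j,\ell}_{\lambda_j;0,k}\rangle\langle\psi^{j,\ell}_{\lambda_j;0,k},\mathbf g\rangle$ ($j\ge J$, $1\le\ell\le s_j$) converge absolutely, and $$\lim_{J'\to+\infty}\Big(\sum_{\ell=1}^r\sum_{k\in\mathbb Z}\langle \mathbf f,\varphi^\ell_{\lambda_J;0,k}\rangle\langle\varphi^\ell_{\lambda_J;0,k},\mathbf g\rangle+\sum_{j=J}^{J'-1}\sum_{\ell=1}^{s_j}\sum_{k\in\mathbb Z}\langle \mathbf f,\psi^{j,\ell}_{\lambda_j;0,k}\rangle\langle\psi^{j,\ell}_{\lambda_j;0,k},\mathbf g\rangle\Big)=2\pi\langle \mathbf f,\mathbf g\rangle.$$ 3. $\Phi,\Psi^j\subseteq L_{2,loc}(\mathbb R)$ for all $j\ge J$; for every $\kappa\in\Lambda\setminus\{0\}$,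 $$I_\Phi^{\lambda_J\kappa}(\lambda_J\xi)+\sum_{j=J}^\infty I_{\Psi^j}^{\lambda_j\kappa}(\lambda_j\xi)=0\qquad\text{for a.e. }\xi\in\mathbb R$$ (only finitely many terms are nonzero); and $$\lim_{J'\to+\infty}\Big(I_\Phi^0(\lambda_J\cdot)+\sum_{j=J}^{J'-1}I_{\Psi^j}^0(\lambda_j\cdot)\Big)=1\quad\text{in the sense of distributions},$$ i.e. the pairings of the left-hand side with each $\mathbf f\in\mathscr D(\mathbb R)$ converge to $\langle1,\mathbf f\rangle$. 4. (Nonstationary tight wavelet frame in the time domain.) There are $\phi^1,\dots,\phi^r\in L_2(\mathbb R)$ and $\eta^{j,1},\dots,\eta^{j,s_j}\in L_2(\mathbb R)$ for all $j\ge J$ with $\varphi^\ell=\widehat{\phi^\ell}$, $\psi^{j,\ell}=\widehat{\eta^{j,\ell}}$, and $$\sum_{\ell=1}^r\sum_{k\in\mathbb Z}|\langle f,\phi^\ell_{\lambda_J^{-1};k}\rangle|^2+\sum_{j=J}^\infty\sum_{\ell=1}^{s_j}\sum_{k\in\mathbb Z}|\langle f,\eta^{j,\ell}_{\lambda_j^{-1};k}\rangle|^2=\|f\|_{L_2(\mathbb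 R)}^2\qquad\forall\,f\in L_2(\mathbb R).$$ -/

import Mathlib

namespace NSWavelet

noncomputable section

open MeasureTheory Filter Topology TopologicalSpace Set
open scoped Distributions ComplexConjugate FourierTransform ENNReal

/-! ### Test functions, distributions, and pairings on the real line -/

/-- Complex-valued smooth compactly supported functions on `ℝ`, with the canonical LF topology. -/
abbrev Test : Type := 𝓓((⊤ : Opens ℝ), ℂ)

/-- Distributions on `ℝ`: continuous `ℂ`-linear functionals on the complex test functions. -/
abbrev Distr : Type := Test →L[ℂ] ℂ

/-- `f ↦ f (c ·)` on test functions supported in a fixed compact set `K`, for `c ≠ 0`. -/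
def dilateOn (c : ℝ) (hc : c ≠ 0) (K : Compacts ℝ) :
    𝓓_{K}(ℝ, ℂ) →L[ℂ] 𝓓_{K.map (fun x : ℝ => c⁻¹ * x) (by fun_prop)}(ℝ, ℂ) :=
  ContDiffMapSupportedIn.mkCLM ℂ (fun f x => f (c * x))
    (fun _ _ _ => rfl) (fun _ _ _ => rfl)
    (fun f => f.contDiff.comp (by fun_prop))
    (fun f x hx => by
      refine f.zero_on_compl (fun hK => hx ?_)
      exact ⟨c * x, hK, by simp [hc]⟩)
    (fun i _ => by
      refine ⟨{i}, |c| ^ i, by positivity, fun f x _ => ?_⟩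
      have h := (ContinuousLinearMap.toSpanSingleton ℝ c).iteratedFDeriv_comp_right
        (f := (f : ℝ → ℂ)) (f.contDiff) x (i := i) (by exact_mod_cast le_top)
      have hfun : (fun x : ℝ => f (c * x)) =
          (f : ℝ → ℂ) ∘ (ContinuousLinearMap.toSpanSingleton ℝ c) := by
        funext y
        simp [ContinuousLinearMap.toSpanSingleton_apply, mul_comm]
      rw [hfun, h]
      refine (ContinuousMultilinearMap.norm_compContinuousLinearMap_le _ _).trans ?_
      rw [mul_comm]
      simp only [Finset.prod_const, Finset.card_univ, Fintype.card_fin, Finset.sup_singleton]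
      have h1 : ‖ContinuousLinearMap.toSpanSingleton ℝ c‖ = |c| := by
        simp
      rw [h1]
      gcongr
      exact ContDiffMapSupportedIn.norm_iteratedFDeriv_apply_le_seminorm_top ℂ)

/-- `f ↦ f (c ·)` as a continuous linear map on test functions, for `c ≠ 0`. -/
def dilate (c : ℝ) (hc : c ≠ 0) : Test →L[ℂ] Test :=
  TestFunction.limitCLM ℂ
    (fun f => ⟨fun x => f (c * x), f.contDiff.comp (by fun_prop),
      f.hasCompactSupport.comp_homeomorph (Homeomorph.mulLeft₀ c hc), fun _ _ => trivial⟩)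
    (fun K _ => TestFunction.ofSupportedInCLM ℂ (fun _ _ => trivial) ∘L dilateOn c hc K)
    (fun _ _ _ => rfl)

/-- `f ↦ g f` as a continuous linear map on test functions, for `g` smooth. -/
def mulSmooth (g : ℝ → ℂ) (hg : ContDiff ℝ (⊤ : ℕ∞) g) : Test →L[ℂ] Test :=
  TestFunction.limitCLM ℂ
    (fun f => ⟨fun x => f x * g x, f.contDiff.mul hg, f.hasCompactSupport.mul_right,
      fun _ _ => trivial⟩)
    (fun _ hK => TestFunction.ofSupportedInCLM ℂ hK ∘L
      ContDiffMapSupportedIn.bilinLeftCLM (ContinuousLinearMap.mul ℂ ℂ) hg)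
    (fun _ _ _ => rfl)

/-- Translation, dilation and modulation of a function:
`f_{c;k,n}(x) = |c|^{1/2} e^{-i n c x} f(c x - k)`. -/
def tdm (f : ℝ → ℂ) (c k n : ℝ) : ℝ → ℂ := fun x =>
  (Real.sqrt |c| : ℂ) * Complex.exp (-Complex.I * n * c * x) * f (c * x - k)

/-- The distribution `T_{c;0,n}`, for `c ≠ 0`, defined by duality:
`T_{c;0,n}(f) = T(|c|^{-1/2} e^{-i n ·} f(c⁻¹ ·))`, so that it extends `tdm · c 0 n` from locally
integrable functions to distributions. (The value for `c = 0` is irrelevant.) -/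
def distrTdm (T : Distr) (c n : ℝ) : Distr :=
  open Classical in
  if hc : c = 0 then 0 else
    T ∘L mulSmooth (fun x => ((Real.sqrt |c|)⁻¹ : ℂ) * Complex.exp (-Complex.I * n * x))
      (by
        have : ContDiff ℝ (⊤ : ℕ∞) (fun x : ℝ => (x : ℂ)) := Complex.ofRealCLM.contDiff
        fun_prop) ∘L
      dilate c⁻¹ (inv_ne_zero hc)

/-- Complex conjugate of a test function. -/
def conjTest (f : Test) : Test :=
  TestFunction.postcompCLM (Complex.conjCLE : ℂ →L[ℝ] ℂ) f

/-- The pairing `⟨T, f⟩ = T(f̄)` of a distribution and a test function. -/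
def pairDT (T : Distr) (f : Test) : ℂ := T (conjTest f)

/-- The pairing `⟨f, T⟩ = conj ⟨T, f⟩` of a test function and a distribution. -/
def pairTD (f : Test) (T : Distr) : ℂ := conj (pairDT T f)

/-- The pairing `⟨f, g⟩ = ∫ f ḡ` of functions. -/
def pairFun (f g : ℝ → ℂ) : ℂ := ∫ x, f x * conj (g x)

/-- The distribution `T` is (given by) the locally integrable function `u`. -/
def IsGivenBy (T : Distr) (u : ℝ → ℂ) : Prop :=
  LocallyIntegrable u ∧ ∀ f : Test, T f = ∫ x, u x * f x

/-- Membership in the local space `L²_loc(ℝ)`. -/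
def MemL2loc (u : ℝ → ℂ) : Prop :=
  ∀ K : Set ℝ, IsCompact K → MemLp u 2 (volume.restrict K)

/-- The Fourier transform on `L²(ℝ)` normalized as `f̂(ξ) = ∫ f(x) e^{-i x ξ} dx`; Mathlib's `𝓕` is
the one with kernel `e^{-2π i x ξ}`. -/
def fourierL2 (f : Lp ℂ 2 (volume : Measure ℝ)) : ℝ → ℂ := fun ξ =>
  (𝓕 f : Lp ℂ 2 (volume : Measure ℝ)) (ξ / (2 * Real.pi))

/-! ### Nonstationary wavelet systems

Throughout, the scales are `lam j`, `j ≥ J`; the generators at the coarsest scale are a family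
indexed by `Fin r`, and the wavelet generators at scale level `j` are a family indexed by
`Fin (s j)`. Entries with `j < J` are never used. -/

variable {r : ℕ} {s : ℤ → ℕ}

/-- The two frequency-based systems form a pair of nonstationary dual wavelet frames in the
distribution space `D'(ℝ)`. -/
def IsDualPairInDistr (J : ℤ) (lam : ℤ → ℝ) (Φ Φt : Fin r → Distr)
    (Ψ Ψt : (j : ℤ) → Fin (s j) → Distr) : Prop :=
  ∀ f g : Test,
    (∀ ℓ, Summable fun k : ℤ =>
      ‖pairTD f (distrTdm (Φ ℓ) (lam J) k) * pairDT (distrTdm (Φt ℓ) (lam J) k) g‖) ∧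
    (∀ j, J ≤ j → ∀ ℓ, Summable fun k : ℤ =>
      ‖pairTD f (distrTdm (Ψ j ℓ) (lam j) k) * pairDT (distrTdm (Ψt j ℓ) (lam j) k) g‖) ∧
    Tendsto (fun J' : ℤ =>
      (∑ ℓ, ∑' k : ℤ,
        pairTD f (distrTdm (Φ ℓ) (lam J) k) * pairDT (distrTdm (Φt ℓ) (lam J) k) g) +
      ∑ j ∈ Finset.Ico J J', ∑ ℓ, ∑' k : ℤ,
        pairTD f (distrTdm (Ψ j ℓ) (lam j) k) * pairDT (distrTdm (Ψt j ℓ) (lam j) k) g)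
      atTop (𝓝 (2 * Real.pi * pairFun f g))

/-- All generators are functions in `L²(ℝ)` and the frequency-based system is a nonstationary tight
wavelet frame of `L²(ℝ)` (with frame bound `2π`). -/
def IsFreqTightFrame (J : ℤ) (lam : ℤ → ℝ) (Φ : Fin r → Distr)
    (Ψ : (j : ℤ) → Fin (s j) → Distr) : Prop :=
  ∃ (u : Fin r → ℝ → ℂ) (v : (j : ℤ) → Fin (s j) → ℝ → ℂ),
    (∀ ℓ, MemLp (u ℓ) 2 ∧ IsGivenBy (Φ ℓ) (u ℓ)) ∧
    (∀ j, J ≤ j → ∀ ℓ, MemLp (v j ℓ) 2 ∧ IsGivenBy (Ψ j ℓ) (v j ℓ)) ∧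
    ∀ f : ℝ → ℂ, MemLp f 2 →
      (∑ ℓ, ∑' k : ℤ, ‖pairFun f (tdm (u ℓ) (lam J) 0 k)‖ₑ ^ 2) +
        ∑' j : {j : ℤ // J ≤ j}, ∑ ℓ, ∑' k : ℤ, ‖pairFun f (tdm (v j ℓ) (lam j) 0 k)‖ₑ ^ 2
      = ENNReal.ofReal (2 * Real.pi) * eLpNorm f 2 volume ^ 2

/-- All generators are Fourier transforms of `L²(ℝ)` functions, and the system generated by these
in the time domain is a nonstationary tight wavelet frame of `L²(ℝ)`. -/
def IsTimeTightFrame (J : ℤ) (lam : ℤ → ℝ) (Φ : Fin r → Distr)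
    (Ψ : (j : ℤ) → Fin (s j) → Distr) : Prop :=
  ∃ (φ : Fin r → Lp ℂ 2 (volume : Measure ℝ))
    (ψ : (j : ℤ) → Fin (s j) → Lp ℂ 2 (volume : Measure ℝ)),
    (∀ ℓ, IsGivenBy (Φ ℓ) (fourierL2 (φ ℓ))) ∧
    (∀ j, J ≤ j → ∀ ℓ, IsGivenBy (Ψ j ℓ) (fourierL2 (ψ j ℓ))) ∧
    ∀ f : ℝ → ℂ, MemLp f 2 →
      (∑ ℓ, ∑' k : ℤ, ‖pairFun f (tdm (φ ℓ) (lam J)⁻¹ k 0)‖ₑ ^ 2) +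
        ∑' j : {j : ℤ // J ≤ j}, ∑ ℓ, ∑' k : ℤ, ‖pairFun f (tdm (ψ j ℓ) (lam j)⁻¹ k 0)‖ₑ ^ 2
      = eLpNorm f 2 volume ^ 2

/-- `I^κ(ξ) = ∑_ℓ conj (u^ℓ(ξ)) ũ^ℓ(ξ + 2πκ)` for `κ ∈ ℤ`, and `I^κ = 0` for `κ ∈ ℝ \ ℤ`. -/
def overlap {m : ℕ} (u ut : Fin m → ℝ → ℂ) (κ ξ : ℝ) : ℂ :=
  open Classical in
  if κ ∈ range (fun n : ℤ => (n : ℝ)) then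
    ∑ ℓ, conj (u ℓ ξ) * ut ℓ (ξ + 2 * Real.pi * κ)
  else 0

/-- `Λ = ⋃_{j ≥ J} lam_j⁻¹ ℤ`. -/
def shiftSet (J : ℤ) (lam : ℤ → ℝ) : Set ℝ :=
  {κ | ∃ j : ℤ, J ≤ j ∧ ∃ n : ℤ, κ = (lam j)⁻¹ * n}

/-- `I_Φ^{lam_J κ}(lam_J ξ) + ∑_{j ≥ J} I_{Ψ^j}^{lam_j κ}(lam_j ξ) = 0` for almost every `ξ`, for all
`κ ∈ Λ \ {0}`. When `lam_j → 0` the sum over `j` has only finitely many nonzero terms. -/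
def OffDiagonalVanishes (J : ℤ) (lam : ℤ → ℝ) (u ut : Fin r → ℝ → ℂ)
    (v vt : (j : ℤ) → Fin (s j) → ℝ → ℂ) : Prop :=
  ∀ κ ∈ shiftSet J lam \ {0}, ∀ᵐ ξ : ℝ,
    overlap u ut (lam J * κ) (lam J * ξ) +
      ∑' j : {j : ℤ // J ≤ j}, overlap (v j) (vt j) (lam j * κ) (lam j * ξ) = 0

/-- `I_Φ^0(lam_J ·) + ∑_{j=J}^{J'-1} I_{Ψ^j}^0(lam_j ·) → 1` as `J' → ∞`, in the sense of
distributions. -/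
def DiagonalTendstoOne (J : ℤ) (lam : ℤ → ℝ) (u ut : Fin r → ℝ → ℂ)
    (v vt : (j : ℤ) → Fin (s j) → ℝ → ℂ) : Prop :=
  ∀ f : Test, Tendsto (fun J' : ℤ =>
      pairFun (fun ξ => overlap u ut 0 (lam J * ξ) +
        ∑ j ∈ Finset.Ico J J', overlap (v j) (vt j) 0 (lam j * ξ)) f)
    atTop (𝓝 (pairFun (fun _ => 1) f))

/-- All generators are functions in `L²_loc(ℝ)`, which satisfy the two conditions above with the
dual generators equal to the primal ones. -/
def IsSelfDualCharacterized (J : ℤ) (lam : ℤ → ℝ) (Φ : Fin r → Distr)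
    (Ψ : (j : ℤ) → Fin (s j) → Distr) : Prop :=
  ∃ (u : Fin r → ℝ → ℂ) (v : (j : ℤ) → Fin (s j) → ℝ → ℂ),
    (∀ ℓ, MemL2loc (u ℓ) ∧ IsGivenBy (Φ ℓ) (u ℓ)) ∧
    (∀ j, J ≤ j → ∀ ℓ, MemL2loc (v j ℓ) ∧ IsGivenBy (Ψ j ℓ) (v j ℓ)) ∧
    OffDiagonalVanishes J lam u u v v ∧
    DiagonalTendstoOne J lam u u v v

end

end NSWavelet

/-! Statement 2 is the hub, and the engine is a fiberization formula. If `u` is locally square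
integrable, the coefficient ⟨f, u_{c;0,k}⟩ is the Fourier integral, at the integer k, of the
compactly supported L² function |c|^{-1/2} f(x/c) conj u(x). Parseval for 2π-periodizations and the
substitution x = cy turn the sum over k into 2π Σ_κ ∫ f(y) conj g(y + 2πκ) conj u(cy) u(c(y + 2πκ))
dy with κ ∈ c⁻¹ℤ (`hasSum_pairTD_mul_pairDT`). Adding the scales gives a sum over shifts κ ∈ Λ
against truncated overlap sums (`truncForm_eq`). As λ_j → 0, bounded parts of Λ are finite, and for
each κ ≠ 0 the overlap sum stops changing after finitely many levels.

For 3 → 2, the terms κ ≠ 0 eventually vanish and the term κ = 0 converges by hypothesis. For 2 → 3,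
test functions concentrated near x₀ and x₀ + 2πκ₀ isolate one shift
(`offDiagonalVanishes_of_tendsto`), and what remains is the diagonal. The formula needs functions,
while 2 speaks of distributions: with f = g the form is a sum of squares bounded by its limit
2π‖f‖², so every generator is bounded in the L² norm and is an L² function by Riesz
(`exists_memLp_of_isDualPair`).

The case f = g of 2 is also the tight frame identity on a dense subspace, which extends to L²
(`tsum_enorm_sq_of_dense`); conversely 1 → 2 is polarization. Finally 1 ↔ 4 is Plancherel: the
Fourier transform exchanges translations with modulations and scale λ⁻¹ with λ. -/

namespace NSWavelet

open MeasureTheory Filter Topology TopologicalSpace Set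
open scoped Distributions ComplexConjugate FourierTransform ENNReal InnerProductSpace SchwartzMap

/-! ### Tight frames in Hilbert spaces -/

section Hilbert

variable {ι H : Type*} [NormedAddCommGroup H] [InnerProductSpace ℂ H]

/-- Polarization of Parseval's identity. -/
theorem hasSum_inner_mul_inner_of_hasSum_sq (e : ι → H) (C : ℝ)
    (h : ∀ f, HasSum (fun i => ‖⟪e i, f⟫_ℂ‖ ^ 2) (C * ‖f‖ ^ 2)) (f g : H) :
    HasSum (fun i => ⟪e i, f⟫_ℂ * conj ⟪e i, g⟫_ℂ) (C * ⟪g, f⟫_ℂ) := by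
  have key : ∀ x : H, HasSum (fun i => ((‖⟪e i, x⟫_ℂ‖ : ℂ)) ^ 2) (C * (‖x‖ : ℂ) ^ 2) := by
    intro x
    have := (Complex.hasSum_ofReal).2 (h x)
    simpa using this
  -- Polarization is one fixed linear combination of four squared norms, so it applies
  -- simultaneously to each coefficient in ℂ and to the vectors in `H`.
  have h1 := ((((key (g + f)).sub (key (g - f))).add
    (((key (g - Complex.I • f)).sub (key (g + Complex.I • f))).mul_right Complex.I)).div_const 4)
  convert! h1 using 1
  · funext i
    have := inner_eq_sum_norm_sq_div_four (𝕜 := ℂ) ⟪e i, g⟫_ℂ ⟪e i, f⟫_ℂ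
    rw [RCLike.inner_apply] at this
    simp only [RCLike.I_to_complex, Complex.coe_algebraMap, smul_eq_mul] at this
    simp only [inner_add_right, inner_sub_right, inner_smul_right]
    exact this
  · have := inner_eq_sum_norm_sq_div_four (𝕜 := ℂ) g f
    simp only [RCLike.I_to_complex, Complex.coe_algebraMap] at this
    rw [this]
    ring

/-- The frame identity in extended reals gives summability in the reals. -/
theorem hasSum_sq_of_tsum_enorm (e : ι → H) (C : ℝ) (hC : 0 ≤ C) (f : H)
    (h : ∑' i, ‖⟪e i, f⟫_ℂ‖ₑ ^ 2 = ENNReal.ofReal C * ‖f‖ₑ ^ 2) :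
    HasSum (fun i => ‖⟪e i, f⟫_ℂ‖ ^ 2) (C * ‖f‖ ^ 2) := by
  have h2 : ∀ i, ‖⟪e i, f⟫_ℂ‖ₑ ^ 2 = ENNReal.ofReal (‖⟪e i, f⟫_ℂ‖ ^ 2) := fun i => by
    rw [ENNReal.ofReal_pow (norm_nonneg _), ofReal_norm]
  have h3 : ENNReal.ofReal C * ‖f‖ₑ ^ 2 = ENNReal.ofReal (C * ‖f‖ ^ 2) := by
    rw [ENNReal.ofReal_mul hC, ENNReal.ofReal_pow (norm_nonneg _), ofReal_norm]
  have hs : Summable fun i => ‖⟪e i, f⟫_ℂ‖ ^ 2 := by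
    have := ENNReal.summable_toReal (f := fun i => ‖⟪e i, f⟫_ℂ‖ₑ ^ 2)
      (by rw [h, h3]; exact ENNReal.ofReal_ne_top)
    simpa using this
  have h4 : ∑' i, ‖⟪e i, f⟫_ℂ‖ ^ 2 = C * ‖f‖ ^ 2 := by
    rw [h3, funext h2, ← ENNReal.ofReal_tsum_of_nonneg (fun _ => by positivity) hs,
      ENNReal.ofReal_eq_ofReal_iff (tsum_nonneg fun _ => by positivity) (by positivity)] at h
    exact h
  exact h4 ▸ hs.hasSum

/-- The tight frame identity extends from a dense subset. -/
theorem tsum_enorm_sq_of_dense (e : ι → H) (C : ℝ≥0∞) (hC : C ≠ ∞) (D : Set H) (hD : Dense D)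
    (h : ∀ f ∈ D, ∑' i, ‖⟪e i, f⟫_ℂ‖ₑ ^ 2 = C * ‖f‖ₑ ^ 2) (f : H) :
    ∑' i, ‖⟪e i, f⟫_ℂ‖ₑ ^ 2 = C * ‖f‖ₑ ^ 2 := by
  let _ : MeasurableSpace ι := ⊤
  have hcont : Continuous fun f : H => C * ‖f‖ₑ ^ 2 :=
    ENNReal.continuous_const_mul hC |>.comp (by fun_prop)
  -- The upper bound passes to the closure because finite partial sums are continuous; the full sum
  -- is so far only lower semicontinuous.
  have hle : ∀ f : H, ∑' i, ‖⟪e i, f⟫_ℂ‖ₑ ^ 2 ≤ C * ‖f‖ₑ ^ 2 := by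
    intro f
    rw [ENNReal.tsum_eq_iSup_sum]
    refine iSup_le fun S => ?_
    have hcl : IsClosed {f : H | ∑ i ∈ S, ‖⟪e i, f⟫_ℂ‖ₑ ^ 2 ≤ C * ‖f‖ₑ ^ 2} :=
      isClosed_le (by fun_prop) hcont
    have : closure D ⊆ {f : H | ∑ i ∈ S, ‖⟪e i, f⟫_ℂ‖ₑ ^ 2 ≤ C * ‖f‖ₑ ^ 2} :=
      hcl.closure_subset_iff.2 fun f hf => by
        simp only [mem_ofPred_eq]
        rw [← h f hf]
        exact ENNReal.sum_le_tsum S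
    exact this (hD f)
  -- The root of the frame sum is an L² norm for counting measure, so Minkowski's inequality
  -- applies.
  let N : H → ℝ≥0∞ := fun f => eLpNorm (fun i => ⟪e i, f⟫_ℂ) 2 Measure.count
  have hN : ∀ f, N f ^ 2 = ∑' i, ‖⟪e i, f⟫_ℂ‖ₑ ^ 2 := by
    intro f
    simp only [N]
    rw [eLpNorm_eq_lintegral_rpow_enorm_toReal (by norm_num) (by norm_num), lintegral_count]
    simp only [ENNReal.toReal_ofNat, ENNReal.rpow_ofNat, one_div]
    rw [← ENNReal.rpow_natCast, ← ENNReal.rpow_mul]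
    norm_num
  have hNadd : ∀ f g, N (f + g) ≤ N f + N g := by
    intro f g
    have : (fun i => ⟪e i, f + g⟫_ℂ) = (fun i => ⟪e i, f⟫_ℂ) + fun i => ⟪e i, g⟫_ℂ := by
      funext i; simp
    simp only [N]
    rw [this]
    exact eLpNorm_add_le (Measurable.of_discrete.aestronglyMeasurable)
      (Measurable.of_discrete.aestronglyMeasurable) (by norm_num)
  refine le_antisymm (hle f) ?_
  obtain ⟨c, hc, hcC⟩ : ∃ c : ℝ≥0∞, c ≠ ∞ ∧ c ^ 2 = C := by
    refine ⟨C ^ (1 / 2 : ℝ), ENNReal.rpow_ne_top_of_nonneg (by norm_num) hC, ?_⟩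
    rw [← ENNReal.rpow_natCast, ← ENNReal.rpow_mul]
    norm_num
  have hNle : ∀ f, N f ≤ c * ‖f‖ₑ := fun f => by
    rw [← (ENNReal.pow_right_strictMono two_ne_zero).le_iff_le, hN, mul_pow, hcC]
    exact hle f
  have hNeq : ∀ f ∈ D, N f = c * ‖f‖ₑ := fun f hf => by
    apply (ENNReal.pow_right_strictMono two_ne_zero).injective
    simp only [hN, mul_pow, hcC]
    exact h f hf
  -- For g in `D`, c‖g‖ = N g ≤ N f + c‖g - f‖ by the upper bound. This is a closed condition on g,
  -- hence holds at g = f.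
  have hfin : c * ‖f‖ₑ ≤ N f := by
    have hcl : IsClosed {g : H | c * ‖g‖ₑ ≤ N f + c * ‖g - f‖ₑ} :=
      isClosed_le ((ENNReal.continuous_const_mul hc).comp (by fun_prop))
        (continuous_const.add ((ENNReal.continuous_const_mul hc).comp (by fun_prop)))
    have : closure D ⊆ {g : H | c * ‖g‖ₑ ≤ N f + c * ‖g - f‖ₑ} :=
      hcl.closure_subset_iff.2 fun g hg => by
        simp only [mem_ofPred_eq]
        rw [← hNeq g hg]
        calc N g = N (f + (g - f)) := by rw [add_sub_cancel]
          _ ≤ N f + N (g - f) := hNadd _ _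
          _ ≤ _ := by gcongr; exact hNle _
    simpa using this (hD f)
  rw [← hN, ← hcC, ← mul_pow]
  gcongr

end Hilbert

/-! ### Parseval's identity for compactly supported functions on the line -/

theorem inner_toLp_toLp {α : Type*} [MeasurableSpace α] {μ : Measure α} {f g : α → ℂ}
    (hf : MemLp f 2 μ) (hg : MemLp g 2 μ) :
    ⟪hg.toLp g, hf.toLp f⟫_ℂ = ∫ x, f x * conj (g x) ∂μ := by
  rw [L2.inner_def]
  refine integral_congr_ae ?_
  filter_upwards [hf.coeFn_toLp, hg.coeFn_toLp] with x h1 h2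
  rw [h1, h2, RCLike.inner_apply]

theorem norm_toLp_sq {α : Type*} [MeasurableSpace α] {μ : Measure α} {f : α → ℂ}
    (hf : MemLp f 2 μ) : ‖hf.toLp f‖ ^ 2 = ∫ x, ‖f x‖ ^ 2 ∂μ := by
  have h := inner_toLp_toLp hf hf
  rw [inner_self_eq_norm_sq_to_K] at h
  have h2 : ∫ x, f x * conj (f x) ∂μ = ((∫ x, ‖f x‖ ^ 2 ∂μ : ℝ) : ℂ) := by
    rw [← integral_complex_ofReal]
    refine integral_congr_ae (ae_of_all _ fun x => ?_)
    simp [Complex.mul_conj']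
  rw [h2] at h
  apply Complex.ofReal_injective
  rw [← h]
  simp

theorem memLp_exp_Ioc (k : ℤ) :
    MemLp (fun x : ℝ => Complex.exp (-Complex.I * k * x)) 2
      (volume.restrict (Ioc 0 (2 * Real.pi))) := by
  refine MemLp.of_bound (Continuous.aestronglyMeasurable (by fun_prop)) 1 (ae_of_all _ fun x => ?_)
  rw [show -Complex.I * k * x = ((-(k * x) : ℝ) : ℂ) * Complex.I by push_cast; ring,
    Complex.norm_exp_ofReal_mul_I]

theorem conj_exp_neg_I_mul (k x : ℝ) :
    conj (Complex.exp (-Complex.I * k * x)) = Complex.exp (Complex.I * k * x) := by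
  rw [← Complex.exp_conj]; simp

/-- Parseval's identity on `(0, 2π]`. -/
theorem hasSum_fourier_Ioc {F G : ℝ → ℂ} (hF : MemLp F 2 (volume.restrict (Ioc 0 (2 * Real.pi))))
    (hG : MemLp G 2 (volume.restrict (Ioc 0 (2 * Real.pi)))) :
    HasSum (fun k : ℤ => (∫ x in Ioc 0 (2 * Real.pi), F x * Complex.exp (Complex.I * k * x)) *
        conj (∫ x in Ioc 0 (2 * Real.pi), G x * Complex.exp (Complex.I * k * x)))
      (2 * Real.pi * ∫ x in Ioc 0 (2 * Real.pi), F x * conj (G x)) := by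
  have hpi := Real.two_pi_pos
  have hin : ∀ {F : ℝ → ℂ} (hF : MemLp F 2 (volume.restrict (Ioc 0 (2 * Real.pi)))) (k : ℤ),
      ⟪(memLp_exp_Ioc k).toLp _, hF.toLp F⟫_ℂ =
        ∫ x in Ioc 0 (2 * Real.pi), F x * Complex.exp (Complex.I * k * x) := by
    intro F hF k
    rw [inner_toLp_toLp]
    have := fun x : ℝ => conj_exp_neg_I_mul k x
    push_cast at this
    simp only [this]
  have hsq : ∀ f : Lp ℂ 2 (volume.restrict (Ioc 0 (2 * Real.pi))),
      HasSum (fun k : ℤ => ‖⟪(memLp_exp_Ioc k).toLp _, f⟫_ℂ‖ ^ 2)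
        (2 * Real.pi * ‖f‖ ^ 2) := by
    intro f
    have hf := Lp.memLp f
    have h1 := hasSum_sq_fourierCoeffOn hpi hf
    -- `fourierCoeffOn` uses e^{-ikx} and the factor 1/(2π), whence the reflection k ↦ -k and the
    -- multiplication by (2π)².
    rw [← (Equiv.neg ℤ).hasSum_iff] at h1
    have h2 := h1.mul_left ((2 * Real.pi) ^ 2)
    have hfe : hf.toLp f = f := Lp.toLp_coeFn f hf
    convert! h2 using 1
    · funext k
      rw [← hfe, hin hf k, hfe]
      simp only [Function.comp_apply, Equiv.neg_apply]
      rw [fourierCoeffOn_eq_integral, intervalIntegral.integral_of_le hpi.le, norm_smul, mul_pow _ ‖∫ x in _, _‖,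
        ← mul_assoc]
      have : (2 * Real.pi) ^ 2 * ‖1 / (2 * Real.pi - 0)‖ ^ 2 = 1 := by
        rw [Real.norm_eq_abs, sq_abs]; field_simp; simp; ring
      rw [this, one_mul]
      congr 2
      refine integral_congr_ae (ae_of_all _ fun x => ?_)
      simp only [smul_eq_mul]
      rw [mul_comm, fourier_coe_apply]
      congr 2
      push_cast
      have : (Real.pi : ℂ) ≠ 0 := by exact_mod_cast Real.pi_ne_zero
      field_simp
      simp
      ring
    · conv_lhs => rw [← hfe, norm_toLp_sq hf]
      rw [intervalIntegral.integral_of_le hpi.le, smul_eq_mul]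
      field_simp
      simp [mul_comm]
  have h := hasSum_inner_mul_inner_of_hasSum_sq _ _ hsq (hF.toLp F) (hG.toLp G)
  simp only [hin, inner_toLp_toLp] at h
  exact_mod_cast h

/-- Integration of a function against a `2π`-periodic one. -/
theorem integral_mul_periodic {F E : ℝ → ℂ} (M : ℕ)
    (hF0 : ∀ x, F x ≠ 0 → x ∈ Ioc (-(2 * Real.pi * M)) (2 * Real.pi * M))
    (hE : Function.Periodic E (2 * Real.pi)) (hFE : Integrable fun x => F x * E x) :
    ∫ x, F x * E x = ∫ x in Ioc 0 (2 * Real.pi),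
      (∑ m ∈ Finset.Ico (-M : ℤ) M, F (x + 2 * Real.pi * m)) * E x := by
  have hpi := Real.two_pi_pos
  have h1 := hasSum_integral_iUnion (f := fun x => F x * E x) (μ := volume)
    (s := fun n : ℤ => Ioc ((0:ℝ) + n • (2 * Real.pi)) (0 + (n + 1) • (2 * Real.pi)))
    (fun n => measurableSet_Ioc) (pairwise_disjoint_Ioc_add_zsmul 0 (2 * Real.pi))
    hFE.integrableOn
  rw [iUnion_Ioc_add_zsmul hpi, setIntegral_univ] at h1
  -- The n-th period cell is (2πn, 2π(n+1)], so the cells -M, …, M-1 cover the support exactly.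
  have h2 : ∀ n ∉ Finset.Ico (-M : ℤ) M,
      ∫ x in Ioc ((0:ℝ) + n • (2 * Real.pi)) (0 + (n + 1) • (2 * Real.pi)), F x * E x = 0 := by
    intro n hn
    refine setIntegral_eq_zero_of_forall_eq_zero fun x hx => ?_
    by_contra hne
    have hx2 := hF0 x (left_ne_zero_of_mul hne)
    apply hn
    simp only [zsmul_eq_mul, zero_add, mem_Ioc] at hx hx2
    push_cast at hx
    rw [Finset.mem_Ico]
    constructor
    · have : (-(M:ℝ)) < n + 1 := by nlinarith
      have : (-(M:ℤ)) < n + 1 := by exact_mod_cast this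
      omega
    · have : (n:ℝ) < M := by nlinarith
      exact_mod_cast this
  rw [← h1.tsum_eq, tsum_eq_sum h2]
  simp_rw [Finset.sum_mul]
  have h3 : ∀ (n : ℤ) (x : ℝ), E x = E (x + 2 * Real.pi * n) := fun n x => by
    rw [mul_comm, ← hE.int_mul n x]
  rw [integral_finsetSum]
  · refine Finset.sum_congr rfl fun n _ => ?_
    rw [← intervalIntegral.integral_of_le (by simp only [zsmul_eq_mul]; push_cast; linarith),
      ← intervalIntegral.integral_of_le hpi.le]
    have := intervalIntegral.integral_comp_add_right (a := 0) (b := 2 * Real.pi)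
      (fun x => F x * E x) (2 * Real.pi * n)
    simp_rw [← h3] at this
    rw [this]
    congr 1 <;> simp only [zsmul_eq_mul] <;> push_cast <;> ring
  · intro n _
    have := (hFE.comp_add_right (2 * Real.pi * n)).integrableOn (s := Ioc 0 (2 * Real.pi))
    simpa only [IntegrableOn, ← h3] using this

/-- Parseval's identity for the sampled Fourier transforms of compactly supported functions. -/
theorem hasSum_sampled_fourier {F G : ℝ → ℂ} (hF : MemLp F 2) (hG : MemLp G 2) (M : ℕ)
    (hF0 : ∀ x, F x ≠ 0 → x ∈ Ioc (-(2 * Real.pi * M)) (2 * Real.pi * M))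
    (hG0 : ∀ x, G x ≠ 0 → x ∈ Ioc (-(2 * Real.pi * M)) (2 * Real.pi * M)) :
    HasSum (fun k : ℤ => (∫ x, F x * Complex.exp (Complex.I * k * x)) *
        conj (∫ x, G x * Complex.exp (Complex.I * k * x)))
      (2 * Real.pi * ∑ n ∈ Finset.Icc (-(2 * M) : ℤ) (2 * M),
        ∫ x, F x * conj (G (x + 2 * Real.pi * n))) := by
  have hpi := Real.two_pi_pos
  have hshift : ∀ {F : ℝ → ℂ}, MemLp F 2 → ∀ c : ℝ, MemLp (fun x => F (x + c)) 2 :=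
    fun hF c => hF.comp_measurePreserving (measurePreserving_add_right volume c)
  let P : (ℝ → ℂ) → ℝ → ℂ := fun F x => ∑ m ∈ Finset.Ico (-M : ℤ) M, F (x + 2 * Real.pi * m)
  have hP : ∀ {F : ℝ → ℂ}, MemLp F 2 → MemLp (P F) 2 (volume.restrict (Ioc 0 (2 * Real.pi))) :=
    fun hF => (memLp_finsetSum _ fun m _ => hshift hF _).restrict _
  have hexp : ∀ k : ℤ, Function.Periodic (fun x : ℝ => Complex.exp (Complex.I * k * x))
      (2 * Real.pi) := by
    intro k x
    simp only
    rw [Complex.exp_eq_exp_iff_exists_int]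
    exact ⟨k, by push_cast; ring⟩
  have hint : ∀ {F : ℝ → ℂ}, MemLp F 2 →
      (∀ x, F x ≠ 0 → x ∈ Ioc (-(2 * Real.pi * M)) (2 * Real.pi * M)) → Integrable F := by
    intro F hF hF0
    have : IntegrableOn F (Ioc (-(2 * Real.pi * M)) (2 * Real.pi * M)) :=
      (hF.restrict _).integrable (by norm_num)
    rw [integrableOn_iff_integrable_of_support_subset (fun x hx => hF0 x hx)] at this
    exact this
  have hA : ∀ {F : ℝ → ℂ}, MemLp F 2 →
      (∀ x, F x ≠ 0 → x ∈ Ioc (-(2 * Real.pi * M)) (2 * Real.pi * M)) → ∀ k : ℤ,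
      ∫ x, F x * Complex.exp (Complex.I * k * x) =
        ∫ x in Ioc 0 (2 * Real.pi), P F x * Complex.exp (Complex.I * k * x) := by
    intro F hF hF0 k
    refine integral_mul_periodic M hF0 (hexp k) ?_
    refine (hint hF hF0).mul_bdd (c := 1) (Continuous.aestronglyMeasurable (by fun_prop))
      (ae_of_all _ fun x => ?_)
    rw [show Complex.I * k * x = ((k * x : ℝ) : ℂ) * Complex.I by push_cast; ring,
      Complex.norm_exp_ofReal_mul_I]
  have h := hasSum_fourier_Ioc (hP hF) (hP hG)
  simp only [← hA hF hF0, ← hA hG hG0] at h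
  convert! h using 2
  -- The finite sum `P G` is not periodic, so the full periodization is used to unfold the integral
  -- over one period back to the line; the two agree on (0, 2π].
  let Q : ℝ → ℂ := fun x => ∑' m : ℤ, G (x + 2 * Real.pi * m)
  have hQ : Function.Periodic Q (2 * Real.pi) := by
    intro x
    simp only [Q]
    rw [← (Equiv.addRight (1 : ℤ)).tsum_eq (fun m : ℤ => G (x + 2 * Real.pi * m))]
    refine tsum_congr fun m => ?_
    simp only [Equiv.coe_addRight]
    congr 1
    push_cast
    ring
  have hQP : ∀ x ∈ Ioc 0 (2 * Real.pi), Q x = P G x := by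
    intro x hx
    refine tsum_eq_sum fun m hm => ?_
    by_contra hne
    have h2 := hG0 _ hne
    apply hm
    simp only [mem_Ioc] at hx h2
    rw [Finset.mem_Ico]
    constructor
    · have : (-(M:ℝ)) < m + 1 := by nlinarith
      have : (-(M:ℤ)) < m + 1 := by exact_mod_cast this
      omega
    · have : (m:ℝ) < M := by nlinarith
      exact_mod_cast this
  -- If x and x + 2πn both lie in (-2πM, 2πM], then |n| < 2M.
  have hQF : ∀ x, F x * conj (Q x) =
      ∑ n ∈ Finset.Icc (-(2 * M) : ℤ) (2 * M), F x * conj (G (x + 2 * Real.pi * n)) := by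
    intro x
    by_cases hx : F x = 0
    · simp [hx]
    rw [← Finset.mul_sum, ← map_sum]
    congr 2
    refine tsum_eq_sum fun m hm => ?_
    by_contra hne
    have h2 := hG0 _ hne
    have h1 := hF0 x hx
    apply hm
    simp only [mem_Ioc] at h1 h2
    rw [Finset.mem_Icc]
    constructor
    · have : (-(2 * M:ℝ)) < m := by nlinarith
      have : (-(2 * M:ℤ)) < m := by exact_mod_cast this
      omega
    · have : (m:ℝ) < 2 * M := by nlinarith
      have : m < 2 * M := by exact_mod_cast this
      omega
  have hI : ∀ n : ℤ, Integrable fun x => F x * conj (G (x + 2 * Real.pi * n)) := fun n =>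
    hF.integrable_mul (hshift hG _).star
  rw [← integral_finsetSum _ fun n _ => hI n]
  simp_rw [← hQF]
  rw [integral_mul_periodic M hF0 (E := fun x => conj (Q x)) (fun x => by simp only [hQ x])]
  · refine setIntegral_congr_fun measurableSet_Ioc fun x hx => ?_
    simp only [hQP x hx, P]
  · simp_rw [hQF]
    exact integrable_finsetSum _ fun n _ => hI n

/-! ### Dilations in `L²` -/

theorem eLpNorm_comp_mul_left {c : ℝ} (hc : c ≠ 0) (f : ℝ → ℂ) :
    eLpNorm (fun x => f (c * x)) 2 volume =
      ENNReal.ofReal |c⁻¹| ^ (1 / 2 : ℝ) * eLpNorm f 2 volume := by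
  have h := (Homeomorph.mulLeft₀ c hc).measurableEmbedding.eLpNorm_map_measure
    (g := f) (p := 2) (μ := volume)
  have h2 : Measure.map (Homeomorph.mulLeft₀ c hc) volume = ENNReal.ofReal |c⁻¹| • volume :=
    Real.map_volume_mul_left hc
  rw [h2, eLpNorm_smul_measure_of_ne_top (by norm_num)] at h
  have h3 : (1 / 2 : ℝ≥0∞).toReal = 1 / 2 := by norm_num
  rw [h3, smul_eq_mul] at h
  exact h.symm

theorem aestronglyMeasurable_comp_mul_left {c : ℝ} (hc : c ≠ 0) {f : ℝ → ℂ}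
    (hf : AEStronglyMeasurable f volume) : AEStronglyMeasurable (fun x => f (c * x)) volume := by
  have := (Homeomorph.mulLeft₀ c hc).measurableEmbedding.aestronglyMeasurable_map_iff
    (g := f) (μ := volume)
  have h2 : Measure.map (Homeomorph.mulLeft₀ c hc) volume = ENNReal.ofReal |c⁻¹| • volume :=
    Real.map_volume_mul_left hc
  rw [h2] at this
  exact this.1 (hf.mono_ac Measure.smul_absolutelyContinuous)

theorem memLp_comp_mul_left {c : ℝ} (hc : c ≠ 0) {f : ℝ → ℂ} (hf : MemLp f 2) :
    MemLp (fun x => f (c * x)) 2 := by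
  refine ⟨aestronglyMeasurable_comp_mul_left hc hf.1, ?_⟩
  rw [eLpNorm_comp_mul_left hc]
  exact ENNReal.mul_lt_top (ENNReal.rpow_lt_top_of_nonneg (by norm_num) ENNReal.ofReal_ne_top) hf.2

theorem ae_comp_mul_left {c : ℝ} (hc : c ≠ 0) {p : ℝ → Prop} (h : ∀ᵐ x : ℝ, p x) :
    ∀ᵐ x : ℝ, p (c * x) := by
  have h2 : Measure.map (fun x => c * x) volume = ENNReal.ofReal |c⁻¹| • volume :=
    Real.map_volume_mul_left hc
  refine ae_of_ae_map (f := fun x : ℝ => c * x) (by fun_prop) ?_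
  rw [h2]
  exact Measure.ae_smul_measure h _

theorem norm_exp_neg_I_mul (n c x : ℝ) : ‖Complex.exp (-Complex.I * n * c * x)‖ = 1 := by
  rw [show -Complex.I * n * c * x = ((-(n * c * x) : ℝ) : ℂ) * Complex.I by push_cast; ring,
    Complex.norm_exp_ofReal_mul_I]

theorem eLpNorm_tdm {c : ℝ} (hc : c ≠ 0) {f : ℝ → ℂ} (hf : AEStronglyMeasurable f volume)
    (k n : ℝ) : eLpNorm (tdm f c k n) 2 volume = eLpNorm f 2 volume := by
  have h1 : eLpNorm (tdm f c k n) 2 volume =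
      eLpNorm ((Real.sqrt |c| : ℂ) • fun x => f (c * x - k)) 2 volume := by
    refine eLpNorm_congr_norm_ae (ae_of_all _ fun x => ?_)
    simp only [tdm, norm_mul, norm_exp_neg_I_mul, Pi.smul_apply, smul_eq_mul, mul_one]
  rw [h1, eLpNorm_const_smul, eLpNorm_comp_mul_left hc (fun x => f (x - k)),
    show (fun x => f (x - k)) = f ∘ fun x => x - k from rfl,
    eLpNorm_comp_measurePreserving hf (measurePreserving_sub_right volume k), ← mul_assoc]
  have : ‖(Real.sqrt |c| : ℂ)‖ₑ * ENNReal.ofReal |c⁻¹| ^ (1 / 2 : ℝ) = 1 := by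
    rw [← ofReal_norm, Complex.norm_real, Real.norm_of_nonneg (Real.sqrt_nonneg _),
      ENNReal.ofReal_rpow_of_nonneg (abs_nonneg _) (by norm_num),
      ← ENNReal.ofReal_mul (Real.sqrt_nonneg _), ← Real.sqrt_eq_rpow, ← Real.sqrt_mul (abs_nonneg _),
      ← abs_mul, mul_inv_cancel₀ hc]
    simp
  rw [this, one_mul]

theorem memLp_tdm {c : ℝ} (hc : c ≠ 0) {f : ℝ → ℂ} (hf : MemLp f 2) (k n : ℝ) :
    MemLp (tdm f c k n) 2 := by
  refine ⟨?_, by rw [eLpNorm_tdm hc hf.1]; exact hf.2⟩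
  have h1 : AEStronglyMeasurable (fun x => f (c * x - k)) volume :=
    aestronglyMeasurable_comp_mul_left hc (f := fun x => f (x - k))
      (hf.1.comp_measurePreserving (measurePreserving_sub_right volume k))
  exact (Continuous.aestronglyMeasurable (by fun_prop)).mul h1

/-! ### Local square integrability -/

theorem memL2loc_of_memLp {u : ℝ → ℂ} (hu : MemLp u 2) : MemL2loc u := fun _ _ => hu.restrict _

theorem MemL2loc.memLp_indicator {u : ℝ → ℂ} (hu : MemL2loc u) {K : Set ℝ} (hK : IsCompact K) :
    MemLp (K.indicator u) 2 :=
  (memLp_indicator_iff_restrict hK.measurableSet).2 (hu K hK)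

theorem MemL2loc.comp_affine {u : ℝ → ℂ} (hu : MemL2loc u) {c : ℝ} (hc : c ≠ 0) (d : ℝ) :
    MemL2loc fun x => u (c * x + d) := by
  intro K hK
  rw [← memLp_indicator_iff_restrict hK.measurableSet]
  have hK' : IsCompact ((fun x => c * x + d) '' K) := hK.image (by fun_prop)
  have h1 := memLp_comp_mul_left hc
    ((hu.memLp_indicator hK').comp_measurePreserving (measurePreserving_add_right volume d))
  convert! h1 using 1
  funext x
  have : c * x + d ∈ (fun x => c * x + d) '' K ↔ x ∈ K := by
    constructor
    · rintro ⟨y, hy, hxy⟩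
      have : y = x := by simpa [hc] using hxy
      exact this ▸ hy
    · exact fun h => ⟨x, h, rfl⟩
  by_cases hx : x ∈ K
  · rw [indicator_of_mem hx, Function.comp_apply, indicator_of_mem (this.2 hx)]
  · rw [indicator_of_notMem hx, Function.comp_apply, indicator_of_notMem (mt this.1 hx)]

theorem MemL2loc.locallyIntegrable_mul_conj {u v : ℝ → ℂ} (hu : MemL2loc u) (hv : MemL2loc v) :
    LocallyIntegrable fun x => conj (u x) * v x := by
  rw [MeasureTheory.locallyIntegrable_iff]
  intro K hK
  exact (hu K hK).star.integrable_mul (hv K hK)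

theorem locallyIntegrable_overlap {m : ℕ} {U : Fin m → ℝ → ℂ} (hU : ∀ ℓ, MemL2loc (U ℓ))
    {c : ℝ} (hc : c ≠ 0) (κ : ℝ) : LocallyIntegrable fun x => overlap U U κ (c * x) := by
  unfold overlap
  split_ifs
  · rw [MeasureTheory.locallyIntegrable_iff]
    intro K hK
    refine integrable_finsetSum _ fun ℓ _ => ?_
    have := ((hU ℓ).comp_affine hc 0).locallyIntegrable_mul_conj
      ((hU ℓ).comp_affine hc (2 * Real.pi * κ))
    simp only [add_zero] at this
    exact this.integrableOn_isCompact hK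
  · exact locallyIntegrable_const 0

/-! ### Pairings with test functions -/

theorem conjTest_apply (f : Test) (x : ℝ) : conjTest f x = conj (f x) := rfl

theorem mulSmooth_dilate_apply {g : ℝ → ℂ} (hg : ContDiff ℝ (⊤ : ℕ∞) g) {c : ℝ} (hc : c ≠ 0)
    (f : Test) (x : ℝ) : mulSmooth g hg (dilate c hc f) x = f (c * x) * g x := rfl

theorem memLp_test (f : Test) : MemLp f 2 :=
  f.continuous.memLp_of_hasCompactSupport f.hasCompactSupport

/-- A smooth compactly supported function as a test function. -/
def toTest (f : ℝ → ℂ) (hf : ContDiff ℝ (⊤ : ℕ∞) f) (hc : HasCompactSupport f) : Test :=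
  ⟨f, hf, hc, fun _ _ => trivial⟩

theorem pairDT_eq_conj (T : Distr) (f : Test) : pairDT T f = conj (pairTD f T) := by
  simp [pairTD]

/-- Duality already moves the dilation and modulation onto the test function, which exhibits the
coefficient as a Fourier integral at frequency n. -/
theorem pairTD_distrTdm {T : Distr} {u : ℝ → ℂ} (h : IsGivenBy T u) {c : ℝ} (hc : c ≠ 0) (n : ℝ)
    (f : Test) : pairTD f (distrTdm T c n) =
      ∫ x, ((Real.sqrt |c|)⁻¹ : ℂ) * f (c⁻¹ * x) * conj (u x) * Complex.exp (Complex.I * n * x) := by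
  unfold pairTD pairDT distrTdm
  rw [dif_neg hc]
  simp only [ContinuousLinearMap.comp_apply]
  rw [h.2, ← integral_conj]
  refine integral_congr_ae (ae_of_all _ fun x => ?_)
  simp only [mulSmooth_dilate_apply, conjTest_apply, map_mul, map_inv₀, Complex.conj_ofReal,
    conj_exp_neg_I_mul, Complex.conj_conj]
  ring

/-- Substitution of cx for x. No integrability is required, since dilations preserve it and both
sides are zero otherwise. -/
theorem pairFun_tdm (f u : ℝ → ℂ) {c : ℝ} (hc : c ≠ 0) (n : ℝ) : pairFun f (tdm u c 0 n) =
      ∫ x, ((Real.sqrt |c|)⁻¹ : ℂ) * f (c⁻¹ * x) * conj (u x) * Complex.exp (Complex.I * n * x) := by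
  have h := Measure.integral_comp_mul_left (fun x =>
    ((Real.sqrt |c|)⁻¹ : ℂ) * f (c⁻¹ * x) * conj (u x) * Complex.exp (Complex.I * n * x)) c
  have h2 : |c| • |c⁻¹| • ∫ x, ((Real.sqrt |c|)⁻¹ : ℂ) * f (c⁻¹ * x) * conj (u x) *
      Complex.exp (Complex.I * n * x) = ∫ x, ((Real.sqrt |c|)⁻¹ : ℂ) * f (c⁻¹ * x) * conj (u x) *
      Complex.exp (Complex.I * n * x) := by
    rw [smul_smul, ← abs_mul, mul_inv_cancel₀ hc, abs_one, one_smul]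
  rw [← h2, ← h, ← integral_smul]
  refine integral_congr_ae (ae_of_all _ fun x => ?_)
  have h3 : ((|c| : ℝ) : ℂ) = (Real.sqrt |c| : ℂ) * Real.sqrt |c| := by
    rw [← Complex.ofReal_mul, Real.mul_self_sqrt (abs_nonneg _)]
  have h4 : (Real.sqrt |c| : ℂ) ≠ 0 := by
    exact_mod_cast (Real.sqrt_pos.2 (abs_pos.2 hc)).ne'
  have h5 := conj_exp_neg_I_mul n (c * x)
  push_cast at h5
  rw [← mul_assoc] at h5
  simp only [tdm, map_mul, Complex.conj_ofReal, sub_zero, h5, Complex.real_smul, h3,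
    inv_mul_cancel_left₀ hc, Complex.ofReal_mul]
  field_simp

theorem pairTD_eq_pairFun {T : Distr} {u : ℝ → ℂ} (h : IsGivenBy T u) {c : ℝ} (hc : c ≠ 0)
    (n : ℝ) (f : Test) : pairTD f (distrTdm T c n) = pairFun f (tdm u c 0 n) := by
  rw [pairTD_distrTdm h hc, pairFun_tdm _ _ hc]

/-! ### The system at a single scale -/

theorem MemL2loc.memLp_test_mul {u : ℝ → ℂ} (hu : MemL2loc u) (a : ℂ) (f : Test) {c : ℝ}
    (hc : c ≠ 0) : MemLp (fun x => a * f (c * x) * conj (u x)) 2 := by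
  have hcs : HasCompactSupport fun x => a * f (c * x) :=
    (f.hasCompactSupport.comp_homeomorph (Homeomorph.mulLeft₀ c hc)).mul_left (f' := f ∘ _)
      (f := fun _ => a)
  have hcont : Continuous fun x => a * f (c * x) :=
    continuous_const.mul (f.continuous.comp (by fun_prop))
  have h1 : MemLp (fun x => a * f (c * x)) ∞ :=
    hcont.memLp_top_of_hasCompactSupport hcs _
  have h2 := (hu.memLp_indicator hcs).star.mul h1 (r := 2)
  convert! h2 using 1
  funext x
  simp only [Pi.mul_apply, Pi.star_apply]
  by_cases hx : x ∈ tsupport fun x => a * f (c * x)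
  · rw [indicator_of_mem hx]; rfl
  · rw [image_eq_zero_of_notMem_tsupport hx, zero_mul, zero_mul]

/-- The fiberization formula for one generator: `hasSum_sampled_fourier` applied to |c|^{-1/2}
f(x/c) conj u(x) and its analogue for g, both supported in |x| ≤ |c|R. Substituting x = cy makes the
shift 2πn into 2πn/c. -/
theorem hasSum_pairTD_mul_pairDT {T : Distr} {u : ℝ → ℂ} (hu : MemL2loc u) (hT : IsGivenBy T u)
    {c : ℝ} (hc : c ≠ 0) (f g : Test) {R : ℝ} (hf : ∀ x, f x ≠ 0 → |x| ≤ R)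
    (hg : ∀ x, g x ≠ 0 → |x| ≤ R) (M : ℕ) (hM : |c| * R < 2 * Real.pi * M) :
    HasSum (fun k : ℤ => pairTD f (distrTdm T c k) * pairDT (distrTdm T c k) g)
      (2 * Real.pi * ∑ n ∈ Finset.Icc (-(2 * M) : ℤ) (2 * M),
        ∫ y, f y * conj (g (y + 2 * Real.pi * (c⁻¹ * n))) *
          (conj (u (c * y)) * u (c * y + 2 * Real.pi * n))) := by
  have hsupp : ∀ f : Test, (∀ x, f x ≠ 0 → |x| ≤ R) → ∀ x,
      ((Real.sqrt |c|)⁻¹ : ℂ) * f (c⁻¹ * x) * conj (u x) ≠ 0 →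
      x ∈ Ioc (-(2 * Real.pi * M)) (2 * Real.pi * M) := by
    intro f hf x hx
    have h1 := hf _ (right_ne_zero_of_mul (left_ne_zero_of_mul hx))
    have h2 : |x| ≤ |c| * R := by
      calc |x| = |c| * |c⁻¹ * x| := by rw [← abs_mul, mul_inv_cancel_left₀ hc]
        _ ≤ _ := by gcongr
    have := abs_lt.1 (h2.trans_lt hM)
    exact ⟨this.1, this.2.le⟩
  have h := hasSum_sampled_fourier (hu.memLp_test_mul (Real.sqrt |c|)⁻¹ f (inv_ne_zero hc))
    (hu.memLp_test_mul (Real.sqrt |c|)⁻¹ g (inv_ne_zero hc)) M (hsupp f hf) (hsupp g hg)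
  convert! h using 1
  · funext k
    have := fun f => pairTD_distrTdm hT hc k f
    push_cast at this
    rw [pairDT_eq_conj, this, this]
  · congr 1
    refine Finset.sum_congr rfl fun n _ => ?_
    have h := Measure.integral_comp_mul_left (fun x => ((Real.sqrt |c|)⁻¹ : ℂ) * f (c⁻¹ * x) *
      conj (u x) * conj (((Real.sqrt |c|)⁻¹ : ℂ) * g (c⁻¹ * (x + 2 * Real.pi * n)) *
      conj (u (x + 2 * Real.pi * n)))) c
    have h2 : ∀ z : ℂ, |c| • |c⁻¹| • z = z := fun z => by
      rw [smul_smul, ← abs_mul, mul_inv_cancel₀ hc, abs_one, one_smul]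
    rw [← h2 (∫ x, ((Real.sqrt |c|)⁻¹ : ℂ) * f (c⁻¹ * x) *
      conj (u x) * conj (((Real.sqrt |c|)⁻¹ : ℂ) * g (c⁻¹ * (x + 2 * Real.pi * n)) *
      conj (u (x + 2 * Real.pi * n)))), ← h, ← integral_smul]
    refine integral_congr_ae (ae_of_all _ fun x => ?_)
    have h3 : ((|c| : ℝ) : ℂ) = (Real.sqrt |c| : ℂ) * Real.sqrt |c| := by
      rw [← Complex.ofReal_mul, Real.mul_self_sqrt (abs_nonneg _)]
    have h4 : (Real.sqrt |c| : ℂ) ≠ 0 := by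
      exact_mod_cast (Real.sqrt_pos.2 (abs_pos.2 hc)).ne'
    have h5 : c⁻¹ * (c * x + 2 * Real.pi * n) = x + 2 * Real.pi * (c⁻¹ * n) := by
      field_simp
    simp only [map_mul, map_inv₀, Complex.conj_ofReal, Complex.conj_conj, Complex.real_smul, h3,
      inv_mul_cancel_left₀ hc, h5]
    field_simp

theorem overlap_intCast {m : ℕ} (u ut : Fin m → ℝ → ℂ) (n : ℤ) (ξ : ℝ) :
    overlap u ut n ξ = ∑ ℓ, conj (u ℓ ξ) * ut ℓ (ξ + 2 * Real.pi * n) := by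
  unfold overlap
  rw [if_pos ⟨n, rfl⟩]

theorem overlap_of_notMem {m : ℕ} (u ut : Fin m → ℝ → ℂ) {κ : ℝ}
    (hκ : κ ∉ range fun n : ℤ => (n : ℝ)) (ξ : ℝ) : overlap u ut κ ξ = 0 := by
  unfold overlap
  rw [if_neg hκ]

theorem integrable_test_mul_test_mul {h : ℝ → ℂ} (hh : LocallyIntegrable h) (f g : Test) (d : ℝ) :
    Integrable fun y => f y * conj (g (y + d)) * h y := by
  have hcont : Continuous fun y => f y * conj (g (y + d)) :=
    f.continuous.mul (Complex.continuous_conj.comp (g.continuous.comp (by fun_prop)))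
  have hcs : HasCompactSupport fun y => f y * conj (g (y + d)) := f.hasCompactSupport.mul_right
  exact hh.integrable_smul_left_of_hasCompactSupport hcont hcs

/-- Indexing the shifts by κ = n/c instead of n lets different scales share one finite set `K`:
elements of `K` outside c⁻¹ℤ contribute nothing because `overlap` is zero there. -/
theorem sum_tsum_pairTD_mul_pairDT {m : ℕ} {T : Fin m → Distr} {U : Fin m → ℝ → ℂ}
    (hU : ∀ ℓ, MemL2loc (U ℓ)) (hT : ∀ ℓ, IsGivenBy (T ℓ) (U ℓ)) {c : ℝ} (hc : c ≠ 0)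
    (f g : Test) {R : ℝ} (hf : ∀ x, f x ≠ 0 → |x| ≤ R) (hg : ∀ x, g x ≠ 0 → |x| ≤ R)
    (K : Finset ℝ) (hK : ∀ n : ℤ, |c⁻¹ * n| ≤ R → c⁻¹ * n ∈ K) :
    (∀ ℓ, Summable fun k : ℤ =>
      ‖pairTD f (distrTdm (T ℓ) c k) * pairDT (distrTdm (T ℓ) c k) g‖) ∧
    ∑ ℓ, ∑' k : ℤ, pairTD f (distrTdm (T ℓ) c k) * pairDT (distrTdm (T ℓ) c k) g =
      2 * Real.pi * ∑ κ ∈ K,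
        ∫ y, f y * conj (g (y + 2 * Real.pi * κ)) * overlap U U (c * κ) (c * y) := by
  obtain ⟨M, hM'⟩ := exists_nat_gt (|c| * R)
  have hM : |c| * R < 2 * Real.pi * M := by
    nlinarith [Real.pi_gt_three, (Nat.cast_nonneg M : (0 : ℝ) ≤ M)]
  have h := fun ℓ => hasSum_pairTD_mul_pairDT (hU ℓ) (hT ℓ) hc f g hf hg M hM
  refine ⟨fun ℓ => (h ℓ).summable.norm, ?_⟩
  simp_rw [(h _).tsum_eq]
  rw [← Finset.mul_sum, Finset.sum_comm]
  congr 1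
  let t : ℝ → ℂ := fun κ =>
    ∫ y, f y * conj (g (y + 2 * Real.pi * κ)) * overlap U U (c * κ) (c * y)
  -- Both supports lie in [-R, R], so a nonzero term forces 2π|κ| ≤ 2R. Hence both index sets
  -- contain the support of `t`, and both sums equal the same `finsum`.
  have ht0 : ∀ κ, t κ ≠ 0 → |κ| ≤ R ∧ ∃ n : ℤ, κ = c⁻¹ * n := by
    intro κ hκ
    constructor
    · by_contra hlt
      apply hκ
      have : ∀ y, f y * conj (g (y + 2 * Real.pi * κ)) * overlap U U (c * κ) (c * y) = 0 := by
        intro y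
        by_contra hne
        have h1 := hf y (left_ne_zero_of_mul (left_ne_zero_of_mul hne))
        have h2 := hg (y + 2 * Real.pi * κ) fun h0 => hne (by simp [h0])
        have h3 : |2 * Real.pi * κ| ≤ 2 * R := by
          calc |2 * Real.pi * κ| = |(y + 2 * Real.pi * κ) - y| := by ring_nf
            _ ≤ |y + 2 * Real.pi * κ| + |y| := abs_sub _ _
            _ ≤ 2 * R := by linarith
        rw [abs_mul, abs_of_pos Real.two_pi_pos] at h3
        nlinarith [Real.pi_gt_three, abs_nonneg κ]
      simp [t, this]
    · by_contra hne
      apply hκ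
      have : c * κ ∉ range fun n : ℤ => (n : ℝ) := by
        rintro ⟨n, hn⟩
        exact hne ⟨n, by simp only at hn; rw [hn, inv_mul_cancel_left₀ hc]⟩
      simp [t, overlap_of_notMem U U this]
  have hinj : Function.Injective fun n : ℤ => c⁻¹ * (n : ℝ) := fun a b hab => by
    simpa [hc] using hab
  have e1 : ∑ κ ∈ K, t κ = ∑ᶠ κ, t κ := by
    symm
    refine finsum_eq_sum_of_support_subset _ fun κ hκ => ?_
    obtain ⟨h1, n, rfl⟩ := ht0 κ hκ
    exact hK n h1
  have e2 : ∑ n ∈ Finset.Icc (-(2 * M) : ℤ) (2 * M), t (c⁻¹ * n) = ∑ᶠ κ, t κ := by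
    rw [← Finset.sum_image (s := Finset.Icc (-(2 * M) : ℤ) (2 * M))
      (g := fun n : ℤ => c⁻¹ * (n : ℝ)) (f := t) hinj.injOn]
    symm
    refine finsum_eq_sum_of_support_subset _ fun κ hκ => ?_
    obtain ⟨h1, n, rfl⟩ := ht0 κ hκ
    simp only [Finset.coe_image, mem_image, Finset.coe_Icc]
    refine ⟨n, ?_, rfl⟩
    have h2 : |(n : ℝ)| ≤ |c| * R := by
      calc |(n : ℝ)| = |c| * |c⁻¹ * n| := by rw [← abs_mul, mul_inv_cancel_left₀ hc]
        _ ≤ _ := by gcongr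
    have h3 := abs_lt.1 (h2.trans_lt hM')
    have h4 : -(M : ℤ) < n := by exact_mod_cast h3.1
    have h5 : n < (M : ℤ) := by exact_mod_cast h3.2
    constructor <;> omega
  change _ = ∑ κ ∈ K, t κ
  rw [e1, ← e2]
  refine Finset.sum_congr rfl fun n _ => ?_
  simp only [t, mul_inv_cancel_left₀ hc, overlap_intCast]
  rw [← integral_finsetSum]
  · simp_rw [Finset.mul_sum]
  · intro ℓ _
    refine integrable_test_mul_test_mul ?_ f g _
    have := ((hU ℓ).comp_affine hc 0).locallyIntegrable_mul_conj
      ((hU ℓ).comp_affine hc (2 * Real.pi * n))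
    simpa only [add_zero] using this

/-! ### Truncated systems -/

theorem sum_subtype_Ico {α : Type*} [AddCommMonoid α] (J J' : ℤ) (F : ℤ → α) :
    ∑ j ∈ (Finset.Ico J J').subtype (J ≤ ·), F j = ∑ j ∈ Finset.Ico J J', F j :=
  Finset.sum_subtype_of_mem F fun _ hj => (Finset.mem_Ico.1 hj).1

theorem tendsto_sum_Ico {α : Type*} [AddCommMonoid α] [TopologicalSpace α] {J : ℤ} {F : ℤ → α}
    {a : α} (h : HasSum (fun j : {j : ℤ // J ≤ j} => F j) a) :
    Tendsto (fun J' : ℤ => ∑ j ∈ Finset.Ico J J', F j) atTop (𝓝 a) := by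
  have h1 : Tendsto (fun J' : ℤ => (Finset.Ico J J').subtype (J ≤ ·)) atTop atTop := by
    refine tendsto_atTop_finset_of_monotone (fun a b hab => ?_) fun j => ⟨j + 1, ?_⟩
    · exact Finset.subtype_mono (Finset.Ico_subset_Ico_right hab)
    · simp [j.2]
  have h2 := h.comp h1
  simpa only [Function.comp_def, sum_subtype_Ico] using h2

section

variable {J : ℤ} {lam : ℤ → ℝ}

theorem eventually_abs_mul_lt_one (hlim : Tendsto lam atTop (𝓝 0)) (R : ℝ) :
    ∃ J₀ : ℤ, ∀ j, J₀ ≤ j → |lam j * R| < 1 := by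
  have h : Tendsto (fun j => |lam j * R|) atTop (𝓝 0) := by
    simpa using (hlim.mul_const R).abs
  exact eventually_atTop.1 (h.eventually (gt_mem_nhds one_pos))

theorem zero_mem_shiftSet : (0 : ℝ) ∈ shiftSet J lam := ⟨J, le_rfl, 0, by simp⟩

/-- Once |λ_j R| < 1, nonzero points of λ_j⁻¹ℤ exceed R in modulus, so only finitely many scales
contribute, each with finitely many points. -/
theorem finite_shiftSet_bounded (hlam : ∀ j, J ≤ j → lam j ≠ 0)
    (hlim : Tendsto lam atTop (𝓝 0)) (R : ℝ) : {κ ∈ shiftSet J lam | |κ| ≤ R}.Finite := by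
  obtain ⟨J₀, hJ₀⟩ := eventually_abs_mul_lt_one hlim R
  have h1 : ∀ j, (J ≤ j) → ∀ n : ℤ, |(lam j)⁻¹ * n| ≤ R → |(n : ℝ)| ≤ |lam j * R| := by
    intro j hj n hn
    calc |(n : ℝ)| = |lam j| * |(lam j)⁻¹ * n| := by
            rw [← abs_mul, mul_inv_cancel_left₀ (hlam j hj)]
      _ ≤ |lam j| * |R| :=
          mul_le_mul_of_nonneg_left (hn.trans (le_abs_self R)) (abs_nonneg _)
      _ = _ := (abs_mul _ _).symm
  have hfin : ((⋃ j ∈ Finset.Ico J J₀, (fun n : ℤ => (lam j)⁻¹ * (n : ℝ)) ''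
      Icc (-⌈|lam j * R|⌉) ⌈|lam j * R|⌉) ∪ {0}).Finite :=
    ((Finset.Ico J J₀).finite_toSet.biUnion fun j _ => (finite_Icc _ _).image _).union
      (finite_singleton 0)
  refine hfin.subset ?_
  rintro κ ⟨⟨j, hj, n, rfl⟩, hκ⟩
  have h2 := h1 j hj n hκ
  by_cases hjJ : j < J₀
  · refine Or.inl (mem_biUnion (Finset.mem_coe.2 (Finset.mem_Ico.2 ⟨hj, hjJ⟩)) ⟨n, ?_, rfl⟩)
    have h3 := abs_le.1 (h2.trans (Int.le_ceil _))
    exact ⟨by exact_mod_cast h3.1, by exact_mod_cast h3.2⟩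
  · right
    have h3 := abs_lt.1 (h2.trans_lt (hJ₀ j (not_lt.1 hjJ)))
    have h4 : (-1 : ℤ) < n := by exact_mod_cast h3.1
    have h5 : n < (1 : ℤ) := by exact_mod_cast h3.2
    have : n = 0 := by omega
    simp [this]

theorem overlap_eq_zero_of_abs_lt_one {m : ℕ} (u ut : Fin m → ℝ → ℂ) {κ : ℝ} (h0 : κ ≠ 0)
    (h1 : |κ| < 1) (ξ : ℝ) : overlap u ut κ ξ = 0 := by
  refine overlap_of_notMem u ut ?_ ξ
  rintro ⟨n, rfl⟩
  have h3 : -1 < (n : ℝ) ∧ (n : ℝ) < 1 := abs_lt.1 h1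
  have h4 : (-1 : ℤ) < n := by exact_mod_cast h3.1
  have h5 : n < (1 : ℤ) := by exact_mod_cast h3.2
  have : n = 0 := by omega
  simp [this] at h0

variable {r : ℕ} {s : ℤ → ℕ}

/-- The sum of the overlap functions up to scale level `J'`. -/
noncomputable def truncOverlap (J : ℤ) (lam : ℤ → ℝ) (u : Fin r → ℝ → ℂ)
    (v : (j : ℤ) → Fin (s j) → ℝ → ℂ) (κ : ℝ) (J' : ℤ) (y : ℝ) : ℂ :=
  overlap u u (lam J * κ) (lam J * y) +
    ∑ j ∈ Finset.Ico J J', overlap (v j) (v j) (lam j * κ) (lam j * y)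

/-- The sesquilinear form of the distributional system up to scale level `J'`. -/
noncomputable def truncForm (J : ℤ) (lam : ℤ → ℝ) (Φ : Fin r → Distr)
    (Ψ : (j : ℤ) → Fin (s j) → Distr) (f g : Test) (J' : ℤ) : ℂ :=
  (∑ ℓ, ∑' k : ℤ,
      pairTD f (distrTdm (Φ ℓ) (lam J) k) * pairDT (distrTdm (Φ ℓ) (lam J) k) g) +
    ∑ j ∈ Finset.Ico J J', ∑ ℓ, ∑' k : ℤ,
      pairTD f (distrTdm (Ψ j ℓ) (lam j) k) * pairDT (distrTdm (Ψ j ℓ) (lam j) k) g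

/-- When 0 < |λ_j κ| < 1 the number λ_j κ is not an integer and level j contributes zero. The
threshold depends on κ but not on y. -/
theorem eventually_truncOverlap_eq_tsum (hlam : ∀ j, J ≤ j → lam j ≠ 0)
    (hlim : Tendsto lam atTop (𝓝 0)) (u : Fin r → ℝ → ℂ) (v : (j : ℤ) → Fin (s j) → ℝ → ℂ)
    {κ : ℝ} (hκ : κ ≠ 0) : ∃ J₀ : ℤ, ∀ J', J₀ ≤ J' → ∀ y, truncOverlap J lam u v κ J' y =
      overlap u u (lam J * κ) (lam J * y) +
        ∑' j : {j : ℤ // J ≤ j}, overlap (v j) (v j) (lam j * κ) (lam j * y) := by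
  obtain ⟨J₀, hJ₀⟩ := eventually_abs_mul_lt_one hlim κ
  refine ⟨J₀, fun J' hJ' y => ?_⟩
  unfold truncOverlap
  rw [tsum_eq_sum (s := (Finset.Ico J J').subtype (J ≤ ·)),
    sum_subtype_Ico J J' fun j => overlap (v j) (v j) (lam j * κ) (lam j * y)]
  intro j hj
  have : J' ≤ j := by
    by_contra hlt
    exact hj (Finset.mem_subtype.2 (Finset.mem_Ico.2 ⟨j.2, not_le.1 hlt⟩))
  exact overlap_eq_zero_of_abs_lt_one _ _ (mul_ne_zero (hlam j j.2) hκ)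
    (hJ₀ j (hJ'.trans this)) _

theorem exists_abs_le_of_ne_zero (f : Test) : ∃ R : ℝ, ∀ x, f x ≠ 0 → |x| ≤ R := by
  obtain ⟨R, hR⟩ := f.hasCompactSupport.isCompact.isBounded.exists_norm_le
  exact ⟨R, fun x hx => hR x (subset_tsupport _ hx)⟩

variable {u : Fin r → ℝ → ℂ} {v : (j : ℤ) → Fin (s j) → ℝ → ℂ} {Φ : Fin r → Distr}
  {Ψ : (j : ℤ) → Fin (s j) → Distr}

theorem locallyIntegrable_truncOverlap (hlam : ∀ j, J ≤ j → lam j ≠ 0)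
    (hu : ∀ ℓ, MemL2loc (u ℓ) ∧ IsGivenBy (Φ ℓ) (u ℓ))
    (hv : ∀ j, J ≤ j → ∀ ℓ, MemL2loc (v j ℓ) ∧ IsGivenBy (Ψ j ℓ) (v j ℓ)) (κ : ℝ) (J' : ℤ) :
    LocallyIntegrable (truncOverlap J lam u v κ J') := by
  unfold truncOverlap
  refine LocallyIntegrable.add
    (locallyIntegrable_overlap (fun ℓ => (hu ℓ).1) (hlam J le_rfl) _) ?_
  rw [MeasureTheory.locallyIntegrable_iff]
  intro K hK
  refine integrable_finsetSum _ fun j hj => ?_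
  have hj' := (Finset.mem_Ico.1 hj).1
  exact (locallyIntegrable_overlap (fun ℓ => (hv j hj' ℓ).1)
    (hlam j hj') _).integrableOn_isCompact hK

/-- Since `K` serves every scale and does not depend on `J'`, the sums over levels and over shifts
can be interchanged. -/
theorem truncForm_eq (hlam : ∀ j, J ≤ j → lam j ≠ 0)
    (hu : ∀ ℓ, MemL2loc (u ℓ) ∧ IsGivenBy (Φ ℓ) (u ℓ))
    (hv : ∀ j, J ≤ j → ∀ ℓ, MemL2loc (v j ℓ) ∧ IsGivenBy (Ψ j ℓ) (v j ℓ)) (f g : Test)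
    {R : ℝ} (hf : ∀ x, f x ≠ 0 → |x| ≤ R) (hg : ∀ x, g x ≠ 0 → |x| ≤ R) (K : Finset ℝ)
    (hK : ∀ κ ∈ shiftSet J lam, |κ| ≤ R → κ ∈ K) (J' : ℤ) :
    truncForm J lam Φ Ψ f g J' = 2 * Real.pi * ∑ κ ∈ K,
      ∫ y, f y * conj (g (y + 2 * Real.pi * κ)) * truncOverlap J lam u v κ J' y := by
  unfold truncForm
  rw [(sum_tsum_pairTD_mul_pairDT (fun ℓ => (hu ℓ).1) (fun ℓ => (hu ℓ).2) (hlam J le_rfl) f g hf hg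
      K fun n hn => hK _ ⟨J, le_rfl, n, rfl⟩ hn).2,
    Finset.sum_congr rfl fun j hj => (sum_tsum_pairTD_mul_pairDT
      (fun ℓ => (hv j (Finset.mem_Ico.1 hj).1 ℓ).1) (fun ℓ => (hv j (Finset.mem_Ico.1 hj).1 ℓ).2)
      (hlam j (Finset.mem_Ico.1 hj).1) f g hf hg
      K fun n hn => hK _ ⟨j, (Finset.mem_Ico.1 hj).1, n, rfl⟩ hn).2,
    ← Finset.mul_sum, ← mul_add, Finset.sum_comm, ← Finset.sum_add_distrib]
  congr 1
  refine Finset.sum_congr rfl fun κ _ => ?_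
  have hi : ∀ j ∈ Finset.Ico J J', Integrable fun y => f y * conj (g (y + 2 * Real.pi * κ)) *
      overlap (v j) (v j) (lam j * κ) (lam j * y) := fun j hj =>
    integrable_test_mul_test_mul (locallyIntegrable_overlap
      (fun ℓ => (hv j (Finset.mem_Ico.1 hj).1 ℓ).1) (hlam j (Finset.mem_Ico.1 hj).1) _) f g _
  rw [← integral_finsetSum _ hi, ← integral_add (integrable_test_mul_test_mul
    (locallyIntegrable_overlap (fun ℓ => (hu ℓ).1) (hlam J le_rfl) _) f g _)
    (integrable_finsetSum _ hi)]
  refine integral_congr_ae (ae_of_all _ fun y => ?_)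
  simp only [truncOverlap, mul_add, Finset.mul_sum]

/-- Only finitely many shifts occur and each nonzero one eventually drops out, so from some level on
the diagonal alone is left. -/
theorem eventually_truncForm_eq (hlam : ∀ j, J ≤ j → lam j ≠ 0)
    (hlim : Tendsto lam atTop (𝓝 0))
    (hu : ∀ ℓ, MemL2loc (u ℓ) ∧ IsGivenBy (Φ ℓ) (u ℓ))
    (hv : ∀ j, J ≤ j → ∀ ℓ, MemL2loc (v j ℓ) ∧ IsGivenBy (Ψ j ℓ) (v j ℓ))
    (hoff : OffDiagonalVanishes J lam u u v v) (f g : Test) :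
    ∀ᶠ J' in atTop, truncForm J lam Φ Ψ f g J' =
      2 * Real.pi * ∫ y, f y * conj (g y) * truncOverlap J lam u v 0 J' y := by
  obtain ⟨R₁, hR₁⟩ := exists_abs_le_of_ne_zero f
  obtain ⟨R₂, hR₂⟩ := exists_abs_le_of_ne_zero g
  -- For zero test functions the two radii may be negative; the 0 keeps κ = 0 in the finite set.
  let R := max 0 (max R₁ R₂)
  have hfin := finite_shiftSet_bounded hlam hlim R
  have hform := truncForm_eq hlam hu hv f g (R := R)
    (fun x hx => (hR₁ x hx).trans ((le_max_left _ _).trans (le_max_right _ _)))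
    (fun x hx => (hR₂ x hx).trans ((le_max_right _ _).trans (le_max_right _ _))) hfin.toFinset
    fun κ h1 h2 => hfin.mem_toFinset.2 ⟨h1, h2⟩
  have hev : ∀ κ ∈ hfin.toFinset, ∀ᶠ J' in atTop, κ ≠ 0 →
      ∫ y, f y * conj (g (y + 2 * Real.pi * κ)) * truncOverlap J lam u v κ J' y = 0 := by
    intro κ hκ
    by_cases h0 : κ = 0
    · simp [h0]
    obtain ⟨J₀, hJ₀⟩ := eventually_truncOverlap_eq_tsum hlam hlim u v h0
    filter_upwards [eventually_ge_atTop J₀] with J' hJ' _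
    refine integral_eq_zero_of_ae ?_
    filter_upwards [hoff κ ⟨(hfin.mem_toFinset.1 hκ).1, h0⟩] with y hy
    rw [hJ₀ J' hJ', hy]
    simp
  rw [← Finset.eventually_all] at hev
  filter_upwards [hev] with J' hJ'
  rw [hform, Finset.sum_eq_single_of_mem 0
    (hfin.mem_toFinset.2 ⟨zero_mem_shiftSet, by simp [R]⟩) hJ']
  simp

theorem isDualPair_of_isSelfDualCharacterized (hlam : ∀ j, J ≤ j → lam j ≠ 0)
    (hlim : Tendsto lam atTop (𝓝 0)) (h : IsSelfDualCharacterized J lam Φ Ψ) :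
    IsDualPairInDistr J lam Φ Φ Ψ Ψ := by
  obtain ⟨u, v, hu, hv, hoff, hdiag⟩ := h
  intro f g
  obtain ⟨R₁, hR₁⟩ := exists_abs_le_of_ne_zero f
  obtain ⟨R₂, hR₂⟩ := exists_abs_le_of_ne_zero g
  have hfin := finite_shiftSet_bounded hlam hlim (max R₁ R₂)
  have hf : ∀ x, f x ≠ 0 → |x| ≤ max R₁ R₂ := fun x hx => (hR₁ x hx).trans (le_max_left _ _)
  have hg : ∀ x, g x ≠ 0 → |x| ≤ max R₁ R₂ := fun x hx => (hR₂ x hx).trans (le_max_right _ _)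
  refine ⟨?_, ?_, ?_⟩
  · exact (sum_tsum_pairTD_mul_pairDT (fun ℓ => (hu ℓ).1) (fun ℓ => (hu ℓ).2) (hlam J le_rfl) f g
      hf hg hfin.toFinset fun n hn => hfin.mem_toFinset.2 ⟨⟨J, le_rfl, n, rfl⟩, hn⟩).1
  · intro j hj
    exact (sum_tsum_pairTD_mul_pairDT (fun ℓ => (hv j hj ℓ).1) (fun ℓ => (hv j hj ℓ).2) (hlam j hj)
      f g hf hg hfin.toFinset fun n hn => hfin.mem_toFinset.2 ⟨⟨j, hj, n, rfl⟩, hn⟩).1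
  · change Tendsto (truncForm J lam Φ Ψ f g) atTop _
    -- The pairing conjugates its second argument, so ⟨1, F⟩ = ∫ f conj g.
    let F : Test := toTest (fun y => conj (f y) * g y)
      ((Complex.conjCLE.contDiff.comp f.contDiff).mul g.contDiff) g.hasCompactSupport.mul_left
    have h1 := (hdiag F).const_mul (2 * Real.pi : ℂ)
    have h2 : pairFun (fun _ => 1) F = pairFun f g := by
      unfold pairFun
      refine integral_congr_ae (ae_of_all _ fun y => ?_)
      change 1 * conj (conj (f y) * g y) = _
      simp
    rw [h2] at h1
    refine h1.congr' ?_
    filter_upwards [eventually_truncForm_eq hlam hlim hu hv hoff f g] with J' hJ'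
    rw [hJ']
    congr 1
    unfold pairFun
    refine integral_congr_ae (ae_of_all _ fun y => ?_)
    change _ * conj (conj (f y) * g y) = _
    simp only [truncOverlap, mul_zero, map_mul, Complex.conj_conj]
    ring

end

/-! ### Recovering the overlap conditions from the distributional identity -/

section

variable {J : ℤ} {lam : ℤ → ℝ} {r : ℕ} {s : ℤ → ℕ}
variable {u : Fin r → ℝ → ℂ} {v : (j : ℤ) → Fin (s j) → ℝ → ℂ} {Φ : Fin r → Distr}
  {Ψ : (j : ℤ) → Fin (s j) → Distr}

/-- A test function which equals `1` on a ball. -/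
theorem exists_test_eq_one (x R : ℝ) (hR : 0 < R) : ∃ g : Test,
    (∀ y, |y - x| ≤ R → g y = 1) ∧ ∀ y, g y ≠ 0 → |y - x| < 2 * R := by
  let b : ContDiffBump x := ⟨R, 2 * R, hR, by linarith⟩
  refine ⟨toTest (fun y => (b y : ℂ)) (Complex.ofRealCLM.contDiff.comp b.contDiff)
    (b.hasCompactSupport.comp_left Complex.ofReal_zero), fun y hy => ?_, fun y hy => ?_⟩
  · change (b y : ℂ) = 1
    rw [b.one_of_mem_closedBall (by simpa [Real.dist_eq] using hy), Complex.ofReal_one]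
  · change (b y : ℂ) ≠ 0 at hy
    by_contra hlt
    apply hy
    rw [b.zero_of_le_dist (by simpa [Real.dist_eq] using hlt), Complex.ofReal_zero]

/-- Take f supported near x₀ and g equal to 1 near x₀ + 2πκ₀, so narrow that no other relevant
shift, in particular not κ = 0, makes them overlap. The form is then eventually the constant 2π∫ f
T, with T the stabilized overlap sum for κ₀, while its limit 2π⟨f, g⟩ is 0. As f is arbitrary near
x₀, T vanishes a.e. there. -/
theorem offDiagonalVanishes_of_tendsto (hlam : ∀ j, J ≤ j → lam j ≠ 0)
    (hlim : Tendsto lam atTop (𝓝 0))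
    (hu : ∀ ℓ, MemL2loc (u ℓ) ∧ IsGivenBy (Φ ℓ) (u ℓ))
    (hv : ∀ j, J ≤ j → ∀ ℓ, MemL2loc (v j ℓ) ∧ IsGivenBy (Ψ j ℓ) (v j ℓ))
    (h : ∀ f g, Tendsto (truncForm J lam Φ Ψ f g) atTop (𝓝 (2 * Real.pi * pairFun f g))) :
    OffDiagonalVanishes J lam u u v v := by
  rintro κ₀ ⟨hκΛ, hκ0 : κ₀ ≠ 0⟩
  obtain ⟨J₀, hJ₀⟩ := eventually_truncOverlap_eq_tsum hlam hlim u v hκ0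
  have hloc := locallyIntegrable_truncOverlap hlam hu hv κ₀ J₀
  suffices hae : ∀ᵐ ξ : ℝ, truncOverlap J lam u v κ₀ J₀ ξ = 0 by
    filter_upwards [hae] with ξ hξ
    rw [← hJ₀ J₀ le_rfl, hξ]
  refine measure_null_of_locally_null _ fun x₀ _ => ?_
  -- Large enough to contain the supports of f (radius δ) and g (radius 2δ), as δ ≤ 1, and to bound
  -- |κ₀|.
  let R := |x₀| + 2 * Real.pi * |κ₀| + 2
  have hfin := finite_shiftSet_bounded hlam hlim R
  have hclosed : IsClosed ({κ ∈ shiftSet J lam | |κ| ≤ R} \ {κ₀}) :=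
    (hfin.subset sdiff_subset).isClosed
  obtain ⟨ε, hε, hball⟩ := Metric.isOpen_iff.1 hclosed.isOpen_compl κ₀ (by simp)
  have hεκ : ∀ κ ∈ shiftSet J lam, |κ| ≤ R → κ ≠ κ₀ → ε ≤ |κ - κ₀| := by
    intro κ h1 h2 h3
    by_contra hlt
    exact hball (by simpa [Real.dist_eq] using hlt) ⟨⟨h1, h2⟩, h3⟩
  -- A competing shift κ with overlapping supports would give 2πε ≤ 2π|κ - κ₀| < δ + 2δ ≤ 3ε, which
  -- is impossible.
  let δ := min 1 ε
  have hδ : 0 < δ := lt_min one_pos hε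
  have hδ1 : δ ≤ 1 := min_le_left _ _
  have hδε : δ ≤ ε := min_le_right _ _
  refine ⟨Metric.ball x₀ δ ∩ _, inter_mem (mem_nhdsWithin_of_mem_nhds
    (Metric.ball_mem_nhds x₀ hδ)) self_mem_nhdsWithin, ?_⟩
  have key := Metric.isOpen_ball.ae_eq_zero_of_integral_contDiff_smul_eq_zero (U := Metric.ball x₀ δ)
    (hloc.locallyIntegrableOn _) ?_
  · rw [ae_iff] at key
    refine measure_mono_null ?_ key
    rintro y ⟨h1, h2⟩ h3
    exact h2 (h3 h1)
  intro ψ hψ hψc hψs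
  obtain ⟨g, hg1, hg2⟩ := exists_test_eq_one (x₀ + 2 * Real.pi * κ₀) δ hδ
  let f : Test := toTest (fun y => (ψ y : ℂ)) (Complex.ofRealCLM.contDiff.comp hψ)
    (hψc.comp_left Complex.ofReal_zero)
  have hfψ : ∀ y, f y = ψ y := fun _ => rfl
  have hf2 : ∀ y, f y ≠ 0 → |y - x₀| < δ := by
    intro y hy
    have : y ∈ Metric.ball x₀ δ := hψs (subset_tsupport _ fun h0 => hy (by simp [hfψ, h0]))
    simpa [Real.dist_eq] using this
  have hpi := Real.pi_gt_three
  have hvanish : ∀ κ ∈ shiftSet J lam, |κ| ≤ R → κ ≠ κ₀ → ∀ y,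
      f y * conj (g (y + 2 * Real.pi * κ)) = 0 := by
    intro κ h1 h2 h3 y
    by_contra hne
    have h4 := hf2 y (left_ne_zero_of_mul hne)
    have h5 := hg2 _ fun h0 => hne (by rw [h0]; simp)
    have h6 : |2 * Real.pi * (κ - κ₀)| < 3 * δ := by
      calc |2 * Real.pi * (κ - κ₀)| =
          |(y + 2 * Real.pi * κ - (x₀ + 2 * Real.pi * κ₀)) - (y - x₀)| := by ring_nf
        _ ≤ _ := abs_sub _ _
        _ < _ := by linarith
    rw [abs_mul, abs_of_pos Real.two_pi_pos] at h6
    nlinarith [hεκ κ h1 h2 h3]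
  have hκ₀R : |κ₀| ≤ R := by
    simp only [R]
    nlinarith [abs_nonneg κ₀, abs_nonneg x₀]
  have hfR : ∀ y, f y ≠ 0 → |y| ≤ R := by
    intro y hy
    have h1 := hf2 y hy
    have h2 := abs_sub_abs_le_abs_sub y x₀
    have h3 : 0 ≤ 2 * Real.pi * |κ₀| := by positivity
    simp only [R]
    linarith
  have hgR : ∀ y, g y ≠ 0 → |y| ≤ R := by
    intro y hy
    have h1 := hg2 y hy
    have h2 := abs_sub_abs_le_abs_sub y (x₀ + 2 * Real.pi * κ₀)
    have h3 := abs_add_le x₀ (2 * Real.pi * κ₀)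
    rw [abs_mul (2 * Real.pi), abs_of_pos Real.two_pi_pos] at h3
    simp only [R]
    linarith
  have hpair : pairFun f g = 0 := by
    refine integral_eq_zero_of_ae (ae_of_all _ fun y => ?_)
    have := hvanish 0 zero_mem_shiftSet (by simp only [abs_zero, R]; positivity) hκ0.symm y
    simpa using this
  have hconst : ∀ J', J₀ ≤ J' → truncForm J lam Φ Ψ f g J' =
      2 * Real.pi * ∫ y, ψ y • truncOverlap J lam u v κ₀ J₀ y := by
    intro J' hJ'
    rw [truncForm_eq hlam hu hv f g hfR hgR hfin.toFinset
      (fun κ h1 h2 => hfin.mem_toFinset.2 ⟨h1, h2⟩) J',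
      Finset.sum_eq_single_of_mem κ₀ (hfin.mem_toFinset.2 ⟨hκΛ, hκ₀R⟩)]
    · congr 1
      refine integral_congr_ae (ae_of_all _ fun y => ?_)
      simp only [hJ₀ J' hJ', ← hJ₀ J₀ le_rfl, Complex.real_smul]
      by_cases hy : f y = 0
      · rw [hy, ← hfψ, hy]; simp
      · rw [hg1 _ (by
          have := (hf2 y hy).le
          rwa [add_sub_add_right_eq_sub]), hfψ]
        simp
    · intro κ hκ hne
      have hκ' := hfin.mem_toFinset.1 hκ
      simp [hvanish κ hκ'.1 hκ'.2 hne]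
  have hl := h f g
  rw [hpair, mul_zero] at hl
  have hl2 := tendsto_const_nhds.congr' (f₁ := fun _ : ℤ =>
    (2 * Real.pi * ∫ y, ψ y • truncOverlap J lam u v κ₀ J₀ y : ℂ)) (f₂ := truncForm J lam Φ Ψ f g)
    (by filter_upwards [eventually_ge_atTop J₀] with J' hJ' using (hconst J' hJ').symm)
  have h0 := tendsto_nhds_unique hl2 hl
  have : (2 * Real.pi : ℂ) ≠ 0 := by exact_mod_cast Real.two_pi_pos.ne'
  exact (mul_eq_zero.1 h0).resolve_left this

/-- With g = 1 wherever f ≠ 0, the form at (conj f, g) is eventually 2π times the pairing of the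
diagonal sum with f, the other shifts having been eliminated by `offDiagonalVanishes_of_tendsto`. -/
theorem diagonalTendstoOne_of_tendsto (hlam : ∀ j, J ≤ j → lam j ≠ 0)
    (hlim : Tendsto lam atTop (𝓝 0))
    (hu : ∀ ℓ, MemL2loc (u ℓ) ∧ IsGivenBy (Φ ℓ) (u ℓ))
    (hv : ∀ j, J ≤ j → ∀ ℓ, MemL2loc (v j ℓ) ∧ IsGivenBy (Ψ j ℓ) (v j ℓ))
    (h : ∀ f g, Tendsto (truncForm J lam Φ Ψ f g) atTop (𝓝 (2 * Real.pi * pairFun f g))) :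
    DiagonalTendstoOne J lam u u v v := by
  intro f
  obtain ⟨R, hR⟩ := exists_abs_le_of_ne_zero f
  obtain ⟨g, hg, -⟩ := exists_test_eq_one 0 (max 1 R) (lt_max_of_lt_left one_pos)
  have hfg : ∀ y, conj (f y) * conj (g y) = conj (f y) := by
    intro y
    by_cases hy : f y = 0
    · simp [hy]
    · rw [hg y (by rw [sub_zero]; exact (hR y hy).trans (le_max_right _ _))]
      simp
  have hpi : (2 * Real.pi : ℂ) ≠ 0 := by exact_mod_cast Real.two_pi_pos.ne'
  have h1 := (h (conjTest f) g).const_mul ((2 * Real.pi : ℂ)⁻¹)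
  have h2 : pairFun (fun _ => 1) f = pairFun (conjTest f) g := by
    unfold pairFun
    refine integral_congr_ae (ae_of_all _ fun y => ?_)
    simp only [conjTest_apply, hfg, one_mul]
  rw [inv_mul_cancel_left₀ hpi, ← h2] at h1
  refine h1.congr' ?_
  filter_upwards [eventually_truncForm_eq hlam hlim hu hv
    (offDiagonalVanishes_of_tendsto hlam hlim hu hv h) (conjTest f) g] with J' hJ'
  rw [hJ', inv_mul_cancel_left₀ hpi]
  unfold pairFun
  refine integral_congr_ae (ae_of_all _ fun y => ?_)
  simp only [conjTest_apply, hfg, truncOverlap, mul_zero]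
  ring

end

/-! ### Distributions which are bounded in the `L²` norm -/

/-- The inclusion of test functions into `L²`. -/
noncomputable def testToLp : Test →ₗ[ℂ] Lp ℂ 2 (volume : Measure ℝ) where
  toFun f := (memLp_test f).toLp f
  map_add' _ _ := rfl
  map_smul' _ _ := rfl

theorem testToLp_apply (f : Test) : testToLp f = (memLp_test f).toLp f := rfl

theorem denseRange_testToLp : DenseRange testToLp := by
  refine (Lp.dense_hasCompactSupport_contDiff (E := ℝ) (F := ℂ) (μ := volume) (p := 2)
    (by norm_num)).mono ?_
  rintro f ⟨g, hfg, hgc, hg⟩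
  refine ⟨toTest g hg hgc, ?_⟩
  rw [testToLp_apply, ← Lp.toLp_coeFn f (Lp.memLp f)]
  exact MemLp.toLp_congr _ _ hfg.symm

/-- A distribution which is bounded in the `L²` norm is given by an `L²` function. -/
theorem exists_memLp_isGivenBy (T : Distr) (C : ℝ) (h : ∀ f : Test, ‖T f‖ ≤ C * ‖testToLp f‖) :
    ∃ u : ℝ → ℂ, MemLp u 2 ∧ IsGivenBy T u := by
  -- Density of test functions extends `T` to L², where Riesz represents it by `w`; the inner
  -- product is antilinear in `w`, hence the conjugate below.
  let L := (T : Test →ₗ[ℂ] ℂ).extendOfNorm testToLp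
  have hL : ∀ f, L (testToLp f) = T f :=
    LinearMap.extendOfNorm_eq denseRange_testToLp ⟨C, h⟩
  let w := (InnerProductSpace.toDual ℂ _).symm L
  have hw := Lp.memLp w
  refine ⟨fun x => conj (w x), hw.star, hw.star.locallyIntegrable (by norm_num), fun f => ?_⟩
  rw [← hL, ← InnerProductSpace.toDual_symm_apply (𝕜 := ℂ) (y := L)]
  change ⟪w, testToLp f⟫_ℂ = _
  rw [testToLp_apply, ← Lp.toLp_coeFn w hw, inner_toLp_toLp]
  refine integral_congr_ae ?_
  filter_upwards [hw.coeFn_toLp] with x hx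
  rw [mul_comm, Lp.toLp_coeFn]

theorem pairFun_self (f : Test) : pairFun f f = ((‖testToLp f‖ ^ 2 : ℝ) : ℂ) := by
  have := inner_toLp_toLp (memLp_test f) (memLp_test f)
  rw [inner_self_eq_norm_sq_to_K] at this
  rw [pairFun, ← this, testToLp_apply]
  simp

/-- The normalized dilation is an L² isometry, so a bound on the coefficient k = 0 alone already
bounds `T`. -/
theorem exists_test_pairTD_eq (T : Distr) {c : ℝ} (hc : c ≠ 0) (g : Test) : ∃ f : Test,
    ‖testToLp f‖ = ‖testToLp g‖ ∧ ‖pairTD f (distrTdm T c 0)‖ = ‖T g‖ := by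
  have h4 : (Real.sqrt |c| : ℂ) ≠ 0 := by
    exact_mod_cast (Real.sqrt_pos.2 (abs_pos.2 hc)).ne'
  refine ⟨conjTest ((Real.sqrt |c| : ℂ) • dilate c hc g), ?_, ?_⟩
  · have h1 : eLpNorm (conjTest ((Real.sqrt |c| : ℂ) • dilate c hc g)) 2 volume =
        eLpNorm (g : ℝ → ℂ) 2 volume := by
      rw [← eLpNorm_tdm hc (memLp_test g).1 0 0]
      refine eLpNorm_congr_norm_ae (ae_of_all _ fun x => ?_)
      change ‖conj ((Real.sqrt |c| : ℂ) * g (c * x))‖ = _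
      simp [tdm]
    rw [testToLp_apply, testToLp_apply, Lp.norm_toLp, Lp.norm_toLp, h1]
  · unfold pairTD pairDT distrTdm
    rw [dif_neg hc, Complex.norm_conj]
    simp only [ContinuousLinearMap.comp_apply]
    congr 2
    ext x
    rw [mulSmooth_dilate_apply]
    change conj (conj ((Real.sqrt |c| : ℂ) * g (c * (c⁻¹ * x)))) * _ = _
    rw [mul_inv_cancel_left₀ hc]
    simp
    field_simp

/-! ### The frame identity as an identity in a Hilbert space -/

theorem tsum_enorm_sum_sigma {ι₁ : Type*} [Fintype ι₁] {ι₂ : Type*} {κ : ι₂ → Type*}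
    [∀ j, Fintype (κ j)] (a : (ι₁ × ℤ) ⊕ (Σ j, κ j × ℤ) → ℝ≥0∞) :
    ∑' i, a i = (∑ ℓ, ∑' k : ℤ, a (Sum.inl (ℓ, k))) +
      ∑' j, ∑ ℓ, ∑' k : ℤ, a (Sum.inr ⟨j, ℓ, k⟩) := by
  rw [Summable.tsum_sum ENNReal.summable ENNReal.summable,
    ENNReal.tsum_prod (f := fun ℓ k => a (Sum.inl (ℓ, k))), tsum_fintype,
    ENNReal.tsum_sigma (fun j p => a (Sum.inr ⟨j, p⟩))]
  congr 1
  refine tsum_congr fun j => ?_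
  rw [ENNReal.tsum_prod (f := fun ℓ k => a (Sum.inr ⟨j, ℓ, k⟩)), tsum_fintype]

theorem hasSum_prod_fintype {κ : Type*} [Fintype κ] {a : κ × ℤ → ℂ} (h : Summable a) :
    HasSum a (∑ ℓ, ∑' k, a (ℓ, k)) := by
  rw [← tsum_fintype (L := .unconditional κ), ← h.tsum_prod]
  exact h.hasSum

section

variable {J : ℤ} {lam : ℤ → ℝ} {r : ℕ} {s : ℤ → ℕ}
  {u : Fin r → ℝ → ℂ} {v : (j : ℤ) → Fin (s j) → ℝ → ℂ} {Φ : Fin r → Distr}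
  {Ψ : (j : ℤ) → Fin (s j) → Distr}

/-- The frequency-based system as a family in `L²`. -/
noncomputable def freqSystem (hlam : ∀ j, J ≤ j → lam j ≠ 0) (hu : ∀ ℓ, MemLp (u ℓ) 2)
    (hv : ∀ j, J ≤ j → ∀ ℓ, MemLp (v j ℓ) 2) :
    (Fin r × ℤ) ⊕ (Σ j : {j : ℤ // J ≤ j}, Fin (s j) × ℤ) → Lp ℂ 2 (volume : Measure ℝ)
  | Sum.inl p => (memLp_tdm (hlam J le_rfl) (hu p.1) 0 p.2).toLp _
  | Sum.inr p => (memLp_tdm (hlam p.1 p.1.2) (hv p.1 p.1.2 p.2.1) 0 p.2.2).toLp _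

variable (hlam : ∀ j, J ≤ j → lam j ≠ 0) (hu : ∀ ℓ, MemLp (u ℓ) 2)
  (hv : ∀ j, J ≤ j → ∀ ℓ, MemLp (v j ℓ) 2)

theorem inner_freqSystem_inl (ℓ : Fin r) (k : ℤ) {f : ℝ → ℂ} (hf : MemLp f 2) :
    ⟪freqSystem hlam hu hv (Sum.inl (ℓ, k)), hf.toLp f⟫_ℂ = pairFun f (tdm (u ℓ) (lam J) 0 k) :=
  inner_toLp_toLp hf (memLp_tdm (hlam J le_rfl) (hu ℓ) 0 k)

theorem inner_freqSystem_inr (j : {j : ℤ // J ≤ j}) (ℓ : Fin (s j)) (k : ℤ) {f : ℝ → ℂ}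
    (hf : MemLp f 2) :
    ⟪freqSystem hlam hu hv (Sum.inr ⟨j, ℓ, k⟩), hf.toLp f⟫_ℂ =
      pairFun f (tdm (v j ℓ) (lam j) 0 k) :=
  inner_toLp_toLp hf (memLp_tdm (hlam j j.2) (hv j j.2 ℓ) 0 k)

theorem inner_freqSystem_inl_test (hΦ : ∀ ℓ, IsGivenBy (Φ ℓ) (u ℓ)) (p : Fin r × ℤ) (f : Test) :
    ⟪freqSystem hlam hu hv (Sum.inl p), testToLp f⟫_ℂ =
      pairTD f (distrTdm (Φ p.1) (lam J) p.2) := by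
  rw [pairTD_eq_pairFun (hΦ p.1) (hlam J le_rfl)]
  exact inner_freqSystem_inl hlam hu hv p.1 p.2 (memLp_test f)

theorem inner_freqSystem_inr_test (hΨ : ∀ j, J ≤ j → ∀ ℓ, IsGivenBy (Ψ j ℓ) (v j ℓ))
    (p : Σ j : {j : ℤ // J ≤ j}, Fin (s j) × ℤ) (f : Test) :
    ⟪freqSystem hlam hu hv (Sum.inr p), testToLp f⟫_ℂ =
      pairTD f (distrTdm (Ψ p.1 p.2.1) (lam p.1) p.2.2) := by
  rw [pairTD_eq_pairFun (hΨ p.1 p.1.2 p.2.1) (hlam p.1 p.1.2)]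
  exact inner_freqSystem_inr hlam hu hv p.1 p.2.1 p.2.2 (memLp_test f)

theorem tsum_freqSystem {f : ℝ → ℂ} (hf : MemLp f 2) :
    ∑' i, ‖⟪freqSystem hlam hu hv i, hf.toLp f⟫_ℂ‖ₑ ^ 2 =
      (∑ ℓ, ∑' k : ℤ, ‖pairFun f (tdm (u ℓ) (lam J) 0 k)‖ₑ ^ 2) +
        ∑' j : {j : ℤ // J ≤ j}, ∑ ℓ, ∑' k : ℤ, ‖pairFun f (tdm (v j ℓ) (lam j) 0 k)‖ₑ ^ 2 := by
  rw [tsum_enorm_sum_sigma]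
  simp only [inner_freqSystem_inl, inner_freqSystem_inr]

/-- Polarized Parseval sums unconditionally over all indices at once, so the terms may be grouped by
generator and level and summed in the order of the levels. -/
theorem isDualPair_of_isFreqTightFrame (hlam : ∀ j, J ≤ j → lam j ≠ 0)
    (h : IsFreqTightFrame J lam Φ Ψ) : IsDualPairInDistr J lam Φ Φ Ψ Ψ := by
  obtain ⟨u, v, hu, hv, h⟩ := h
  have hu' := fun ℓ => (hu ℓ).1
  have hv' := fun j hj ℓ => (hv j hj ℓ).1
  have hpi : (0 : ℝ) ≤ 2 * Real.pi := Real.two_pi_pos.le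
  have hsum := hasSum_inner_mul_inner_of_hasSum_sq (freqSystem hlam hu' hv') (2 * Real.pi)
    (fun f => hasSum_sq_of_tsum_enorm _ _ hpi f (by
      have hf := Lp.memLp f
      have h1 := tsum_freqSystem hlam hu' hv' hf
      rw [h f hf, Lp.toLp_coeFn] at h1
      rw [h1, Lp.enorm_def]))
  intro f g
  have hfg := hsum (testToLp f) (testToLp g)
  have e1 : (fun i => ⟪freqSystem hlam hu' hv' i, testToLp f⟫_ℂ *
      conj ⟪freqSystem hlam hu' hv' i, testToLp g⟫_ℂ) ∘ Sum.inl = fun p : Fin r × ℤ =>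
      pairTD f (distrTdm (Φ p.1) (lam J) p.2) * pairDT (distrTdm (Φ p.1) (lam J) p.2) g := by
    funext p
    simp only [Function.comp_apply, pairDT_eq_conj,
      inner_freqSystem_inl_test hlam hu' hv' fun ℓ => (hu ℓ).2]
  have e2 : (fun i => ⟪freqSystem hlam hu' hv' i, testToLp f⟫_ℂ *
      conj ⟪freqSystem hlam hu' hv' i, testToLp g⟫_ℂ) ∘ Sum.inr =
      fun p : Σ j : {j : ℤ // J ≤ j}, Fin (s j) × ℤ =>
      pairTD f (distrTdm (Ψ p.1 p.2.1) (lam p.1) p.2.2) *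
      pairDT (distrTdm (Ψ p.1 p.2.1) (lam p.1) p.2.2) g := by
    funext p
    simp only [Function.comp_apply, pairDT_eq_conj,
      inner_freqSystem_inr_test hlam hu' hv' fun j hj ℓ => (hv j hj ℓ).2]
  have hs1 := e1 ▸ hfg.summable.comp_injective Sum.inl_injective
  have hs2 := e2 ▸ hfg.summable.comp_injective Sum.inr_injective
  have hs2j := fun j : {j : ℤ // J ≤ j} => hs2.sigma_factor j
  refine ⟨fun ℓ => (hs1.prod_factor ℓ).norm, fun j hj ℓ =>
    ((hs2j ⟨j, hj⟩).prod_factor ℓ).norm, ?_⟩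
  have h2 := hs2.hasSum.sigma fun j => hasSum_prod_fintype (hs2j j)
  have h3 := tendsto_sum_Ico (F := fun j => ∑ ℓ, ∑' k : ℤ,
    pairTD f (distrTdm (Ψ j ℓ) (lam j) k) * pairDT (distrTdm (Ψ j ℓ) (lam j) k) g) h2
  have h4 := h3.const_add (∑ ℓ, ∑' k : ℤ,
    pairTD f (distrTdm (Φ ℓ) (lam J) k) * pairDT (distrTdm (Φ ℓ) (lam J) k) g)
  have h5 := HasSum.sum (e1 ▸ hasSum_prod_fintype hs1)
    (hfg.summable.comp_injective Sum.inr_injective).hasSum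
  have h6 := h5.unique hfg
  rw [e2, testToLp_apply, testToLp_apply, inner_toLp_toLp] at h6
  simp only at h6 h4
  rw [h6] at h4
  rw [Complex.ofReal_mul, Complex.ofReal_ofNat] at h4
  exact h4

end

/-! ### From the distributional identity to the frame property -/

section

variable {J : ℤ} {lam : ℤ → ℝ} {r : ℕ} {s : ℤ → ℕ}
  {Φ : Fin r → Distr} {Ψ : (j : ℤ) → Fin (s j) → Distr}

/-- The energy of a test function at a single scale. -/
noncomputable def energy {m : ℕ} (T : Fin m → Distr) (c : ℝ) (f : Test) : ℝ :=
  ∑ ℓ, ∑' k : ℤ, ‖pairTD f (distrTdm (T ℓ) c k)‖ ^ 2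

theorem energy_nonneg {m : ℕ} (T : Fin m → Distr) (c : ℝ) (f : Test) : 0 ≤ energy T c f :=
  Finset.sum_nonneg fun _ _ => tsum_nonneg fun _ => by positivity

theorem pairTD_mul_pairDT_self (T : Distr) (f : Test) :
    pairTD f T * pairDT T f = ((‖pairTD f T‖ ^ 2 : ℝ) : ℂ) := by
  rw [pairDT_eq_conj, Complex.mul_conj']
  push_cast
  rfl

/-- Here self-duality enters: on the diagonal f = g the form is a sum of squares, hence increasing
in `J'`. -/
theorem truncForm_self (f : Test) (J' : ℤ) : truncForm J lam Φ Ψ f f J' =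
    ((energy Φ (lam J) f + ∑ j ∈ Finset.Ico J J', energy (Ψ j) (lam j) f : ℝ) : ℂ) := by
  simp only [truncForm, energy, pairTD_mul_pairDT_self, ← Complex.ofReal_tsum]
  push_cast
  rfl

theorem summable_sq_of_summable_norm {T : Distr} {c : ℝ} {f : Test}
    (h : Summable fun k : ℤ => ‖pairTD f (distrTdm T c k) * pairDT (distrTdm T c k) f‖) :
    Summable fun k : ℤ => ‖pairTD f (distrTdm T c k)‖ ^ 2 := by
  refine h.congr fun k => ?_
  rw [pairTD_mul_pairDT_self, Complex.norm_real, Real.norm_of_nonneg (by positivity)]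

theorem norm_sq_le_energy {m : ℕ} {T : Fin m → Distr} {c : ℝ} {f : Test}
    (h : ∀ ℓ, Summable fun k : ℤ => ‖pairTD f (distrTdm (T ℓ) c k)‖ ^ 2) (ℓ : Fin m) :
    ‖pairTD f (distrTdm (T ℓ) c 0)‖ ^ 2 ≤ energy T c f := by
  have h1 := (h ℓ).le_tsum 0 fun _ _ => by positivity
  rw [Int.cast_zero] at h1
  refine h1.trans ?_
  exact Finset.single_le_sum (f := fun ℓ => ∑' k : ℤ, ‖pairTD f (distrTdm (T ℓ) c k)‖ ^ 2)
    (fun _ _ => tsum_nonneg fun _ => by positivity) (Finset.mem_univ ℓ)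

theorem sum_tsum_enorm_eq_energy {m : ℕ} {T : Fin m → Distr} {c : ℝ} {f : Test}
    (h : ∀ ℓ, Summable fun k : ℤ => ‖pairTD f (distrTdm (T ℓ) c k)‖ ^ 2) :
    ∑ ℓ, ∑' k : ℤ, ‖pairTD f (distrTdm (T ℓ) c k)‖ₑ ^ 2 = ENNReal.ofReal (energy T c f) := by
  unfold energy
  rw [ENNReal.ofReal_sum_of_nonneg fun _ _ => tsum_nonneg fun _ => by positivity]
  refine Finset.sum_congr rfl fun ℓ _ => ?_
  rw [ENNReal.ofReal_tsum_of_nonneg (fun _ => by positivity) (h ℓ)]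
  refine tsum_congr fun k => ?_
  rw [ENNReal.ofReal_pow (norm_nonneg _), ofReal_norm]

theorem exists_memLp_of_energy_le {m : ℕ} {T : Fin m → Distr} {c : ℝ} (hc : c ≠ 0) {B : ℝ}
    (hs : ∀ f ℓ, Summable fun k : ℤ => ‖pairTD f (distrTdm (T ℓ) c k)‖ ^ 2)
    (hB : ∀ f, energy T c f ≤ B * ‖testToLp f‖ ^ 2) (ℓ : Fin m) :
    ∃ u : ℝ → ℂ, MemLp u 2 ∧ IsGivenBy (T ℓ) u := by
  refine exists_memLp_isGivenBy (T ℓ) (Real.sqrt B) fun g => ?_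
  obtain ⟨f, h1, h2⟩ := exists_test_pairTD_eq (T ℓ) hc g
  rw [← h1, ← h2]
  have h3 := (norm_sq_le_energy (hs f) ℓ).trans (hB f)
  calc ‖pairTD f (distrTdm (T ℓ) c 0)‖ = Real.sqrt (‖pairTD f (distrTdm (T ℓ) c 0)‖ ^ 2) :=
        (Real.sqrt_sq (norm_nonneg _)).symm
    _ ≤ Real.sqrt (B * ‖testToLp f‖ ^ 2) := Real.sqrt_le_sqrt h3
    _ = _ := by rw [Real.sqrt_mul' _ (by positivity), Real.sqrt_sq (norm_nonneg _)]

/-- An increasing sequence stays below its limit, so the energy of each level is at most 2π‖f‖².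
This bounds every generator in the L² norm. -/
theorem exists_memLp_of_isDualPair (hlam : ∀ j, J ≤ j → lam j ≠ 0)
    (h : IsDualPairInDistr J lam Φ Φ Ψ Ψ) :
    ∃ (u : Fin r → ℝ → ℂ) (v : (j : ℤ) → Fin (s j) → ℝ → ℂ),
      (∀ ℓ, MemLp (u ℓ) 2 ∧ IsGivenBy (Φ ℓ) (u ℓ)) ∧
      (∀ j, J ≤ j → ∀ ℓ, MemLp (v j ℓ) 2 ∧ IsGivenBy (Ψ j ℓ) (v j ℓ)) ∧
      ∀ f : Test, Tendsto (fun J' => energy Φ (lam J) f +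
        ∑ j ∈ Finset.Ico J J', energy (Ψ j) (lam j) f) atTop
        (𝓝 (2 * Real.pi * ‖testToLp f‖ ^ 2)) := by
  have hlim : ∀ f : Test, Tendsto (fun J' => energy Φ (lam J) f +
      ∑ j ∈ Finset.Ico J J', energy (Ψ j) (lam j) f) atTop
      (𝓝 (2 * Real.pi * ‖testToLp f‖ ^ 2)) := by
    intro f
    have h1 : Tendsto (truncForm J lam Φ Ψ f f) atTop _ := (h f f).2.2
    rw [pairFun_self, ← Complex.ofReal_ofNat, ← Complex.ofReal_mul, ← Complex.ofReal_mul] at h1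
    have h2 := (Complex.continuous_re.tendsto _).comp h1
    simpa only [Function.comp_def, truncForm_self, Complex.ofReal_re] using h2
  have hle : ∀ (f : Test) (J' : ℤ), energy Φ (lam J) f +
      ∑ j ∈ Finset.Ico J J', energy (Ψ j) (lam j) f ≤ 2 * Real.pi * ‖testToLp f‖ ^ 2 := by
    intro f
    refine Monotone.ge_of_tendsto (fun a b hab => ?_) (hlim f)
    gcongr
    exact fun _ _ _ => energy_nonneg _ _ _
  have hu : ∀ ℓ, ∃ u : ℝ → ℂ, MemLp u 2 ∧ IsGivenBy (Φ ℓ) u :=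
    exists_memLp_of_energy_le (B := 2 * Real.pi) (hlam J le_rfl)
      (fun f ℓ => summable_sq_of_summable_norm ((h f f).1 ℓ))
      -- At `J' = J` the sum over levels is empty and only the energy of `Φ` remains.
      fun f => by simpa using hle f J
  have hv : ∀ j ℓ, ∃ v : ℝ → ℂ, J ≤ j → MemLp v 2 ∧ IsGivenBy (Ψ j ℓ) v := by
    intro j ℓ
    by_cases hj : J ≤ j
    · obtain ⟨v, hv⟩ := exists_memLp_of_energy_le (B := 2 * Real.pi) (hlam j hj)
        (fun f ℓ => summable_sq_of_summable_norm ((h f f).2.1 j hj ℓ)) (fun f => by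
          refine le_trans ?_ (hle f (j + 1))
          refine le_add_of_nonneg_of_le (energy_nonneg _ _ _) ?_
          exact Finset.single_le_sum (f := fun j => energy (Ψ j) (lam j) f)
            (fun _ _ => energy_nonneg _ _ _) (Finset.mem_Ico.2 ⟨hj, lt_add_one j⟩)) ℓ
      exact ⟨v, fun _ => hv⟩
    · exact ⟨0, fun hj' => (hj hj').elim⟩
  choose u hu using hu
  choose v hv using hv
  exact ⟨u, v, hu, fun j hj ℓ => hv j ℓ hj, hlim⟩

/-- The identity on test functions is the case f = g; `tsum_enorm_sq_of_dense` carries it to L². -/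
theorem isFreqTightFrame_of_isDualPair (hlam : ∀ j, J ≤ j → lam j ≠ 0)
    (h : IsDualPairInDistr J lam Φ Φ Ψ Ψ) : IsFreqTightFrame J lam Φ Ψ := by
  obtain ⟨u, v, hu, hv, hlim⟩ := exists_memLp_of_isDualPair hlam h
  refine ⟨u, v, hu, hv, ?_⟩
  have hu' := fun ℓ => (hu ℓ).1
  have hv' := fun j hj ℓ => (hv j hj ℓ).1
  have key := tsum_enorm_sq_of_dense (freqSystem hlam hu' hv') (ENNReal.ofReal (2 * Real.pi))
    ENNReal.ofReal_ne_top (range testToLp) denseRange_testToLp ?_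
  · intro f hf
    rw [← tsum_freqSystem hlam hu' hv' hf, key, Lp.enorm_toLp]
  rintro _ ⟨f, rfl⟩
  rw [tsum_enorm_sum_sigma]
  simp only [inner_freqSystem_inl_test hlam hu' hv' fun ℓ => (hu ℓ).2,
    inner_freqSystem_inr_test hlam hu' hv' fun j hj ℓ => (hv j hj ℓ).2]
  rw [sum_tsum_enorm_eq_energy fun ℓ => summable_sq_of_summable_norm ((h f f).1 ℓ)]
  have h2 : ∀ j : {j : ℤ // J ≤ j}, ∑ ℓ, ∑' k : ℤ, ‖pairTD f (distrTdm (Ψ j ℓ) (lam j) k)‖ₑ ^ 2 =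
      ENNReal.ofReal (energy (Ψ j) (lam j) f) := fun j =>
    sum_tsum_enorm_eq_energy fun ℓ => summable_sq_of_summable_norm ((h f f).2.1 j j.2 ℓ)
  simp only [h2]
  -- In `ℝ≥0∞` every series is summable, so the limit of the truncations is the full sum and
  -- uniqueness of limits gives its value.
  have h3 := (tendsto_sum_Ico (J := J) (F := fun j => ENNReal.ofReal (energy (Ψ j) (lam j) f))
    ENNReal.summable.hasSum).const_add (ENNReal.ofReal (energy Φ (lam J) f))
  have h4 := ENNReal.tendsto_ofReal (hlim f)
  have h5 : ∀ J' : ℤ, ENNReal.ofReal (energy Φ (lam J) f +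
      ∑ j ∈ Finset.Ico J J', energy (Ψ j) (lam j) f) = ENNReal.ofReal (energy Φ (lam J) f) +
      ∑ j ∈ Finset.Ico J J', ENNReal.ofReal (energy (Ψ j) (lam j) f) := fun J' => by
    rw [ENNReal.ofReal_add (energy_nonneg _ _ _)
      (Finset.sum_nonneg fun _ _ => energy_nonneg _ _ _),
      ENNReal.ofReal_sum_of_nonneg fun _ _ => energy_nonneg _ _ _]
  simp only [h5] at h4
  rw [tendsto_nhds_unique h3 h4, ENNReal.ofReal_mul Real.two_pi_pos.le,
    ENNReal.ofReal_pow (norm_nonneg _), ofReal_norm]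

theorem isSelfDualCharacterized_of_isDualPair (hlam : ∀ j, J ≤ j → lam j ≠ 0)
    (hlim : Tendsto lam atTop (𝓝 0)) (h : IsDualPairInDistr J lam Φ Φ Ψ Ψ) :
    IsSelfDualCharacterized J lam Φ Ψ := by
  obtain ⟨u, v, hu, hv, -⟩ := exists_memLp_of_isDualPair hlam h
  have hu' : ∀ ℓ, MemL2loc (u ℓ) ∧ IsGivenBy (Φ ℓ) (u ℓ) :=
    fun ℓ => ⟨memL2loc_of_memLp (hu ℓ).1, (hu ℓ).2⟩
  have hv' : ∀ j, J ≤ j → ∀ ℓ, MemL2loc (v j ℓ) ∧ IsGivenBy (Ψ j ℓ) (v j ℓ) :=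
    fun j hj ℓ => ⟨memL2loc_of_memLp (hv j hj ℓ).1, (hv j hj ℓ).2⟩
  have h' : ∀ f g, Tendsto (truncForm J lam Φ Ψ f g) atTop (𝓝 (2 * Real.pi * pairFun f g)) :=
    fun f g => (h f g).2.2
  exact ⟨u, v, hu', hv', offDiagonalVanishes_of_tendsto hlam hlim hu' hv' h',
    diagonalTendstoOne_of_tendsto hlam hlim hu' hv' h'⟩

end

/-! ### Plancherel's theorem for the system -/

theorem tdm_congr_ae {c : ℝ} (hc : c ≠ 0) (k n : ℝ) {f g : ℝ → ℂ} (h : f =ᵐ[volume] g) :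
    tdm f c k n =ᵐ[volume] tdm g c k n := by
  have h1 : ∀ᵐ x : ℝ, f (x - k) = g (x - k) :=
    (measurePreserving_sub_right volume k).quasiMeasurePreserving.ae h
  filter_upwards [ae_comp_mul_left hc h1] with x hx
  simp only [tdm, hx]

/-- Translation, dilation and modulation on `L²`. -/
noncomputable def tdmLp {c : ℝ} (hc : c ≠ 0) (k n : ℝ) (f : Lp ℂ 2 (volume : Measure ℝ)) :
    Lp ℂ 2 (volume : Measure ℝ) :=
  (memLp_tdm hc (Lp.memLp f) k n).toLp _

theorem tdmLp_toLp {c : ℝ} (hc : c ≠ 0) (k n : ℝ) {f : ℝ → ℂ} (hf : MemLp f 2) :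
    tdmLp hc k n (hf.toLp f) = (memLp_tdm hc hf k n).toLp _ :=
  MemLp.toLp_congr _ _ (tdm_congr_ae hc k n hf.coeFn_toLp)

theorem isometry_tdmLp {c : ℝ} (hc : c ≠ 0) (k n : ℝ) : Isometry (tdmLp hc k n) := by
  intro f g
  rw [tdmLp, tdmLp, Lp.edist_toLp_toLp, Lp.edist_def]
  have : tdm f c k n - tdm g c k n = tdm (f - g) c k n := by
    funext x
    simp [tdm, mul_sub]
  rw [this, eLpNorm_tdm hc ((Lp.aestronglyMeasurable f).sub (Lp.aestronglyMeasurable g))]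

theorem integral_comp_inv_mul_sub (c k : ℝ) (G : ℝ → ℂ) :
    ∫ x, G (c⁻¹ * x - k) = |c| * ∫ y, G y := by
  rw [Measure.integral_comp_mul_left (fun x => G (x - k)) c⁻¹, inv_inv,
    integral_sub_right_eq_self G k, Complex.real_smul]

/-- Translation by k becomes modulation; its frequency is 2πk because of the kernel e^{-2πixξ}. -/
theorem fourier_tdm {c : ℝ} (hc : c ≠ 0) (k : ℝ) (φ : ℝ → ℂ) :
    𝓕 (tdm φ c⁻¹ k 0) = tdm (𝓕 φ) c 0 (2 * Real.pi * k) := by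
  funext w
  rw [Real.fourier_real_eq_integral_exp_smul]
  have h := integral_comp_inv_mul_sub c k fun y =>
    Complex.exp (((-2 * Real.pi * (c * (y + k)) * w : ℝ) : ℂ) * Complex.I) *
      ((Real.sqrt |c⁻¹| : ℂ) * φ y)
  simp only [sub_add_cancel, mul_inv_cancel_left₀ hc] at h
  simp only [tdm, smul_eq_mul, Complex.ofReal_zero, mul_zero, zero_mul, Complex.exp_zero, mul_one]
  rw [h, sub_zero, Real.fourier_real_eq_integral_exp_smul, ← integral_const_mul,
    ← integral_const_mul]
  refine integral_congr_ae (ae_of_all _ fun y => ?_)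
  have h1 : ((|c| : ℝ) : ℂ) * (Real.sqrt |c⁻¹| : ℂ) = (Real.sqrt |c| : ℂ) := by
    rw [← Complex.ofReal_mul, abs_inv, Real.sqrt_inv, ← div_eq_mul_inv, Real.div_sqrt]
  have h2 : Complex.exp (((-2 * Real.pi * (c * (y + k)) * w : ℝ) : ℂ) * Complex.I) =
      Complex.exp (-Complex.I * ((2 * Real.pi * k : ℝ) : ℂ) * c * w) *
      Complex.exp (((-2 * Real.pi * y * (c * w) : ℝ) : ℂ) * Complex.I) := by
    rw [← Complex.exp_add]
    congr 1
    push_cast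
    ring
  simp only [smul_eq_mul]
  rw [h2, ← h1]
  ring

theorem exists_schwartz_eq_tdm {c : ℝ} (hc : c ≠ 0) (k : ℝ) (φ : 𝓢(ℝ, ℂ)) :
    ∃ ψ : 𝓢(ℝ, ℂ), (ψ : ℝ → ℂ) = tdm φ c k 0 := by
  let e : ℝ ≃L[ℝ] ℝ := ContinuousLinearEquiv.smulLeft (Units.mk0 c hc)
  refine ⟨(Real.sqrt |c| : ℂ) • SchwartzMap.compCLMOfContinuousLinearEquiv ℂ e
    (φ.compSubConstCLM ℂ k), ?_⟩
  funext x
  have he : e x = c * x := rfl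
  simp [tdm, he]

/-- Both sides are continuous in φ, and on the dense Schwartz functions the integral formula
`fourier_tdm` applies. -/
theorem fourier_tdmLp {c : ℝ} (hc : c ≠ 0) (k : ℝ) (φ : Lp ℂ 2 (volume : Measure ℝ)) :
    𝓕 (tdmLp (inv_ne_zero hc) k 0 φ) = tdmLp hc 0 (2 * Real.pi * k) (𝓕 φ) := by
  have hF : Continuous fun f : Lp ℂ 2 (volume : Measure ℝ) =>
      (𝓕 f : Lp ℂ 2 (volume : Measure ℝ)) := (Lp.fourierTransformₗᵢ ℝ ℂ).continuous
  refine DenseRange.induction_on (p := fun φ : Lp ℂ 2 (volume : Measure ℝ) =>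
    𝓕 (tdmLp (inv_ne_zero hc) k 0 φ) = tdmLp hc 0 (2 * Real.pi * k) (𝓕 φ))
    (SchwartzMap.denseRange_toLpCLM (E := ℝ) (F := ℂ) (p := 2) (μ := volume)
      ENNReal.ofNat_ne_top) φ ?_ ?_
  · exact isClosed_eq (hF.comp (isometry_tdmLp _ _ _).continuous)
      ((isometry_tdmLp _ _ _).continuous.comp hF)
  intro φ
  obtain ⟨ψ, hψ⟩ := exists_schwartz_eq_tdm (inv_ne_zero hc) k φ
  change 𝓕 (tdmLp (inv_ne_zero hc) k 0 (φ.toLp 2)) =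
    tdmLp hc 0 (2 * Real.pi * k) (𝓕 (φ.toLp 2))
  have h1 : tdmLp (inv_ne_zero hc) k 0 (φ.toLp 2) = ψ.toLp 2 := by
    rw [SchwartzMap.toLp, tdmLp_toLp]
    exact MemLp.toLp_congr _ _ (by rw [hψ])
  rw [h1, SchwartzMap.toLp_fourier_eq, SchwartzMap.toLp_fourier_eq, SchwartzMap.toLp,
    SchwartzMap.toLp, tdmLp_toLp]
  refine MemLp.toLp_congr _ _ (ae_of_all _ fun w => ?_)
  rw [SchwartzMap.fourier_coe, SchwartzMap.fourier_coe, hψ, fourier_tdm hc]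

theorem fourierL2_eq (f : Lp ℂ 2 (volume : Measure ℝ)) : fourierL2 f =
    fun ξ => (𝓕 f : Lp ℂ 2 (volume : Measure ℝ)) ((2 * Real.pi)⁻¹ * ξ) := by
  funext ξ
  rw [fourierL2, div_eq_inv_mul]

theorem memLp_fourierL2 (f : Lp ℂ 2 (volume : Measure ℝ)) : MemLp (fourierL2 f) 2 := by
  rw [fourierL2_eq]
  exact memLp_comp_mul_left (inv_ne_zero Real.two_pi_pos.ne') (Lp.memLp _)

theorem eLpNorm_fourierL2_sq (f : Lp ℂ 2 (volume : Measure ℝ)) :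
    eLpNorm (fourierL2 f) 2 volume ^ 2 = ENNReal.ofReal (2 * Real.pi) * ‖f‖ₑ ^ 2 := by
  rw [fourierL2_eq, eLpNorm_comp_mul_left (inv_ne_zero Real.two_pi_pos.ne'), mul_pow, inv_inv,
    abs_of_pos Real.two_pi_pos, ← ENNReal.rpow_natCast, ← ENNReal.rpow_mul, ← Lp.enorm_def,
    ← ofReal_norm, Lp.norm_fourier_eq, ofReal_norm]
  norm_num

theorem exists_fourierL2_ae_eq {f : ℝ → ℂ} (hf : MemLp f 2) :
    ∃ F : Lp ℂ 2 (volume : Measure ℝ), fourierL2 F =ᵐ[volume] f := by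
  have hf' := memLp_comp_mul_left Real.two_pi_pos.ne' hf
  refine ⟨(Lp.fourierTransformₗᵢ ℝ ℂ).symm (hf'.toLp _), ?_⟩
  have h1 : (𝓕 ((Lp.fourierTransformₗᵢ ℝ ℂ).symm (hf'.toLp _)) : Lp ℂ 2 (volume : Measure ℝ)) =
      hf'.toLp _ := (Lp.fourierTransformₗᵢ ℝ ℂ).apply_symm_apply _
  rw [fourierL2_eq, h1]
  filter_upwards [ae_comp_mul_left (inv_ne_zero Real.two_pi_pos.ne') hf'.coeFn_toLp] with x hx
  rw [hx, mul_inv_cancel_left₀ Real.two_pi_pos.ne']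

/-- Plancherel followed by w = ξ/(2π), which produces the factor (2π)⁻¹ and reduces the frequency
2πk to k. -/
theorem pairFun_tdm_eq_fourierL2 {c : ℝ} (hc : c ≠ 0) (k : ℝ) {f : ℝ → ℂ} (hf : MemLp f 2)
    (φ : Lp ℂ 2 (volume : Measure ℝ)) : pairFun f (tdm φ c⁻¹ k 0) =
      ((2 * Real.pi)⁻¹ : ℝ) * pairFun (fourierL2 (hf.toLp f)) (tdm (fourierL2 φ) c 0 k) := by
  have hpi := Real.two_pi_pos.ne'
  have h1 : pairFun f (tdm φ c⁻¹ k 0) = ⟪tdmLp (inv_ne_zero hc) k 0 φ, hf.toLp f⟫_ℂ :=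
    (inner_toLp_toLp hf (memLp_tdm (inv_ne_zero hc) (Lp.memLp φ) k 0)).symm
  have hg := Lp.memLp (𝓕 (hf.toLp f) : Lp ℂ 2 (volume : Measure ℝ))
  rw [h1, ← Lp.inner_fourier_eq, fourier_tdmLp hc,
    ← Lp.toLp_coeFn (𝓕 (hf.toLp f) : Lp ℂ 2 (volume : Measure ℝ)) hg, tdmLp, inner_toLp_toLp]
  have h2 := Measure.integral_comp_mul_left (fun w =>
    (𝓕 (hf.toLp f) : Lp ℂ 2 (volume : Measure ℝ)) w *
    conj (tdm (𝓕 φ : Lp ℂ 2 (volume : Measure ℝ)) c 0 (2 * Real.pi * k) w)) (2 * Real.pi)⁻¹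
  have h3 : pairFun (fourierL2 (hf.toLp f)) (tdm (fourierL2 φ) c 0 k) = ∫ x,
      (𝓕 (hf.toLp f) : Lp ℂ 2 (volume : Measure ℝ)) ((2 * Real.pi)⁻¹ * x) *
      conj (tdm (𝓕 φ : Lp ℂ 2 (volume : Measure ℝ)) c 0 (2 * Real.pi * k)
        ((2 * Real.pi)⁻¹ * x)) := by
    unfold pairFun
    rw [fourierL2_eq, fourierL2_eq]
    refine integral_congr_ae (ae_of_all _ fun x => ?_)
    have h4 : -Complex.I * ((2 * Real.pi * k : ℝ) : ℂ) * c * (((2 * Real.pi)⁻¹ * x : ℝ) : ℂ) =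
        -Complex.I * k * c * x := by
      have : (Real.pi : ℂ) ≠ 0 := by exact_mod_cast Real.pi_ne_zero
      push_cast
      field_simp
    simp only [tdm, sub_zero, h4]
    rw [show (2 * Real.pi)⁻¹ * (c * x) = c * ((2 * Real.pi)⁻¹ * x) by ring]
  rw [h3, h2, inv_inv, abs_of_pos Real.two_pi_pos, Complex.real_smul, ← mul_assoc,
    ← Complex.ofReal_mul, inv_mul_cancel₀ hpi, Complex.ofReal_one, one_mul]

theorem pairFun_congr_ae {f f' g g' : ℝ → ℂ} (h : f =ᵐ[volume] f') (h' : g =ᵐ[volume] g') :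
    pairFun f g = pairFun f' g' := by
  refine integral_congr_ae ?_
  filter_upwards [h, h'] with x h1 h2
  rw [h1, h2]

theorem IsGivenBy.congr_ae {T : Distr} {u u' : ℝ → ℂ} (h : IsGivenBy T u)
    (huu' : u =ᵐ[volume] u') : IsGivenBy T u' := by
  refine ⟨h.1.congr huu', fun f => (h.2 f).trans (integral_congr_ae ?_)⟩
  filter_upwards [huu'] with x hx
  rw [hx]

section

variable {J : ℤ} {lam : ℤ → ℝ} {r : ℕ} {s : ℤ → ℕ}
  {Φ : Fin r → Distr} {Ψ : (j : ℤ) → Fin (s j) → Distr}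

theorem tsum_time_eq_tsum_freq (hlam : ∀ j, J ≤ j → lam j ≠ 0)
    (φ : Fin r → Lp ℂ 2 (volume : Measure ℝ))
    (ψ : (j : ℤ) → Fin (s j) → Lp ℂ 2 (volume : Measure ℝ)) {f : ℝ → ℂ} (hf : MemLp f 2) :
    (∑ ℓ, ∑' k : ℤ, ‖pairFun f (tdm (φ ℓ) (lam J)⁻¹ k 0)‖ₑ ^ 2) +
        ∑' j : {j : ℤ // J ≤ j}, ∑ ℓ, ∑' k : ℤ, ‖pairFun f (tdm (ψ j ℓ) (lam j)⁻¹ k 0)‖ₑ ^ 2 =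
      ENNReal.ofReal (2 * Real.pi)⁻¹ ^ 2 *
        ((∑ ℓ, ∑' k : ℤ, ‖pairFun (fourierL2 (hf.toLp f))
            (tdm (fourierL2 (φ ℓ)) (lam J) 0 k)‖ₑ ^ 2) +
          ∑' j : {j : ℤ // J ≤ j}, ∑ ℓ, ∑' k : ℤ, ‖pairFun (fourierL2 (hf.toLp f))
            (tdm (fourierL2 (ψ j ℓ)) (lam j) 0 k)‖ₑ ^ 2) := by
  have h : ∀ {c : ℝ} (_ : c ≠ 0) (k : ℤ) (φ : Lp ℂ 2 (volume : Measure ℝ)),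
      ‖pairFun f (tdm φ c⁻¹ k 0)‖ₑ ^ 2 = ENNReal.ofReal (2 * Real.pi)⁻¹ ^ 2 *
        ‖pairFun (fourierL2 (hf.toLp f)) (tdm (fourierL2 φ) c 0 k)‖ₑ ^ 2 := by
    intro c hc k φ
    rw [pairFun_tdm_eq_fourierL2 hc k hf, enorm_mul, mul_pow, ← ofReal_norm, Complex.norm_real,
      Real.norm_of_nonneg (inv_nonneg.2 Real.two_pi_pos.le)]
  rw [mul_add, Finset.mul_sum, ← ENNReal.tsum_mul_left]
  congr 1
  · refine Finset.sum_congr rfl fun ℓ _ => ?_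
    rw [← ENNReal.tsum_mul_left]
    exact tsum_congr fun k => h (hlam J le_rfl) k _
  · refine tsum_congr fun j => ?_
    rw [Finset.mul_sum]
    refine Finset.sum_congr rfl fun ℓ _ => ?_
    rw [← ENNReal.tsum_mul_left]
    exact tsum_congr fun k => h (hlam j j.2) k _

/-- The factor (2π)⁻² comes from the squared coefficients, one 2π from the frame bound and one from
Plancherel. -/
theorem ofReal_two_pi_cancel (a : ℝ≥0∞) : ENNReal.ofReal (2 * Real.pi)⁻¹ ^ 2 *
    (ENNReal.ofReal (2 * Real.pi) * (ENNReal.ofReal (2 * Real.pi) * a)) = a := by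
  have h : ENNReal.ofReal (2 * Real.pi)⁻¹ * ENNReal.ofReal (2 * Real.pi) = 1 := by
    rw [← ENNReal.ofReal_mul (inv_nonneg.2 Real.two_pi_pos.le),
      inv_mul_cancel₀ Real.two_pi_pos.ne', ENNReal.ofReal_one]
  calc _ = (ENNReal.ofReal (2 * Real.pi)⁻¹ * ENNReal.ofReal (2 * Real.pi)) ^ 2 * a := by ring
    _ = a := by rw [h]; simp

theorem isTimeTightFrame_of_isFreqTightFrame (hlam : ∀ j, J ≤ j → lam j ≠ 0)
    (h : IsFreqTightFrame J lam Φ Ψ) : IsTimeTightFrame J lam Φ Ψ := by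
  obtain ⟨u, v, hu, hv, h⟩ := h
  have hφ : ∀ ℓ, ∃ φ, fourierL2 φ =ᵐ[volume] u ℓ := fun ℓ => exists_fourierL2_ae_eq (hu ℓ).1
  have hψ : ∀ j ℓ, ∃ ψ, J ≤ j → fourierL2 ψ =ᵐ[volume] v j ℓ := by
    intro j ℓ
    by_cases hj : J ≤ j
    · obtain ⟨ψ, hψ⟩ := exists_fourierL2_ae_eq (hv j hj ℓ).1
      exact ⟨ψ, fun _ => hψ⟩
    · exact ⟨0, fun hj' => (hj hj').elim⟩
  choose φ hφ using hφ
  choose ψ hψ using hψ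
  refine ⟨φ, ψ, fun ℓ => (hu ℓ).2.congr_ae (hφ ℓ).symm,
    fun j hj ℓ => (hv j hj ℓ).2.congr_ae (hψ j ℓ hj).symm, fun f hf => ?_⟩
  have h1 : ∀ ℓ (k : ℤ), pairFun (fourierL2 (hf.toLp f)) (tdm (fourierL2 (φ ℓ)) (lam J) 0 k) =
      pairFun (fourierL2 (hf.toLp f)) (tdm (u ℓ) (lam J) 0 k) := fun ℓ k =>
    pairFun_congr_ae (ae_eq_refl _) (tdm_congr_ae (hlam J le_rfl) _ _ (hφ ℓ))
  have h2 : ∀ (j : {j : ℤ // J ≤ j}) ℓ (k : ℤ),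
      pairFun (fourierL2 (hf.toLp f)) (tdm (fourierL2 (ψ j ℓ)) (lam j) 0 k) =
      pairFun (fourierL2 (hf.toLp f)) (tdm (v j ℓ) (lam j) 0 k) := fun j ℓ k =>
    pairFun_congr_ae (ae_eq_refl _) (tdm_congr_ae (hlam j j.2) _ _ (hψ j ℓ j.2))
  rw [tsum_time_eq_tsum_freq hlam φ ψ hf]
  simp only [h1, h2]
  rw [h _ (memLp_fourierL2 _), eLpNorm_fourierL2_sq, ofReal_two_pi_cancel, Lp.enorm_toLp]

theorem isFreqTightFrame_of_isTimeTightFrame (hlam : ∀ j, J ≤ j → lam j ≠ 0)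
    (h : IsTimeTightFrame J lam Φ Ψ) : IsFreqTightFrame J lam Φ Ψ := by
  obtain ⟨φ, ψ, hφ, hψ, h⟩ := h
  refine ⟨fun ℓ => fourierL2 (φ ℓ), fun j ℓ => fourierL2 (ψ j ℓ),
    fun ℓ => ⟨memLp_fourierL2 _, hφ ℓ⟩, fun j hj ℓ => ⟨memLp_fourierL2 _, hψ j hj ℓ⟩,
    fun f hf => ?_⟩
  -- The Fourier transform is onto L², so the frequency identity for f is the time identity for its
  -- preimage F.
  obtain ⟨F, hF⟩ := exists_fourierL2_ae_eq hf
  have h1 := tsum_time_eq_tsum_freq hlam φ ψ (Lp.memLp F)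
  rw [h F (Lp.memLp F), Lp.toLp_coeFn, ← Lp.enorm_def] at h1
  have h2 : ∀ g, pairFun (fourierL2 F) g = pairFun f g := fun g =>
    pairFun_congr_ae hF (ae_eq_refl _)
  simp only [h2] at h1
  rw [← eLpNorm_congr_ae hF, eLpNorm_fourierL2_sq, h1, ← mul_assoc, ← mul_assoc]
  have h3 := ofReal_two_pi_cancel 1
  rw [mul_one] at h3
  rw [show ENNReal.ofReal (2 * Real.pi) * ENNReal.ofReal (2 * Real.pi) *
    ENNReal.ofReal (2 * Real.pi)⁻¹ ^ 2 = 1 by rw [mul_comm]; exact h3, one_mul]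

end

end NSWavelet

theorem mainTheorem10 (J : ℤ) (lam : ℤ → ℝ) (hlam : ∀ j, J ≤ j → lam j ≠ 0)
    (hlim : Filter.Tendsto lam Filter.atTop (nhds 0))
    (r : ℕ) (s : ℤ → ℕ)
    (Φ : Fin r → NSWavelet.Distr) (Ψ : (j : ℤ) → Fin (s j) → NSWavelet.Distr) :
    List.TFAE [
      NSWavelet.IsFreqTightFrame J lam Φ Ψ,
      NSWavelet.IsDualPairInDistr J lam Φ Φ Ψ Ψ,
      NSWavelet.IsSelfDualCharacterized J lam Φ Ψ,
      NSWavelet.IsTimeTightFrame J lam Φ Ψ] := by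
  tfae_have 1 → 2 := NSWavelet.isDualPair_of_isFreqTightFrame hlam
  tfae_have 2 → 1 := NSWavelet.isFreqTightFrame_of_isDualPair hlam
  tfae_have 2 → 3 := NSWavelet.isSelfDualCharacterized_of_isDualPair hlam hlim
  tfae_have 3 → 2 := NSWavelet.isDualPair_of_isSelfDualCharacterized hlam hlim
  tfae_have 1 → 4 := NSWavelet.isTimeTightFrame_of_isFreqTightFrame hlam
  tfae_have 4 → 1 := NSWavelet.isFreqTightFrame_of_isTimeTightFrame hlam
  tfae_finish
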